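/- Let $\Sigma$ be a closed oriented smooth surface. An oriented knot diagram $D$ on $\Sigma$ is an oriented immersed closed curve whose only multiple points are finitely many transverse double points, each with a choice of over- and under-branch; $C(D)$ denotes its set of crossing points. Let $\gamma$ be a closed curve on $\Sigma$, and consider the diagrams $D$ with $[\gamma]\cdot[D]=0$. Move $\gamma$ by a homotopy so that it is smooth, avoids the crossings of $D$ and meets $D$ transversally; the algebraic intersection number $[\gamma]\cdot[D]$ is then the signed number of intersection points, where a point is positive if the pair of tangent vectors of $\gamma$ and $D$ (in this order) orients the tangent plane, and negative otherwise. A coloring of $D$ assigns an integer to each of the parts into which $\gamma$ divides $D$, such that, walking along $D$, the integer increases by one at a positive and decreases by one at a negative intersection point. For $c\in C(D)$ let $f_\gamma(c)$ be the integer on the over-arc at $c$ minus the integer on the under-arc at $c$. **Lemma 2.2.** For each such $D$ with $[\gamma]\cdot[D]=0$ the assignment $f_\gamma\colon C(D)\to\mathbb Z$ is well defined (a coloring exists, and $f_\gamma$ depends neither on the coloring nor on the chosen homotopy of $\gamma$), the number $[\gamma]\cdot[D]$ is unchanged when $D$ undergoes a Reidemeister move, and $f_\gamma$ satisfies the chord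 index axioms: 1. if a crossing point $c$ is involved in a first Reidemeister move, then $f_\gamma(c)=0$; 2. if two crossing points $c_1,c_2$ are involved in a second Reidemeister move, then $f_\gamma(c_1)=f_\gamma(c_2)$; 3. if three crossing points $c_1,c_2,c_3$ are involved in a third Reidemeister move, then their values under $f_\gamma$ are preserved respectively under the move; 4. for any crossing point that is not involved in a Reidemeister move, its value under $f_\gamma$ is preserved under this move. -/

import Mathlib

open scoped Manifold ContDiff Topology

noncomputable section

/-- The model plane. -/
abbrev Plane : Type := EuclideanSpace ℝ (Fin 2)

/-- The circle `ℝ / ℤ` parametrizing closed curves. -/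
abbrev Circ : Type := UnitAddCircle

/-- The atlas of the surface is oriented: all coordinate changes have positive Jacobian.
A smooth surface with such an atlas is an oriented surface. -/
def IsOrientedAtlas (S : Type*) [TopologicalSpace S] [ChartedSpace Plane S] : Prop :=
  ∀ e ∈ atlas Plane S, ∀ e' ∈ atlas Plane S, ∀ x ∈ (e.symm.trans e').source,
    0 < (fderiv ℝ (e.symm.trans e') x).det

section Curves

variable {S : Type*} [TopologicalSpace S] [ChartedSpace Plane S]

/-- A closed curve is smooth if the corresponding 1-periodic map `ℝ → S` is. -/
def SmoothCurve (γ : C(Circ, S)) : Prop :=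
  ContMDiff 𝓘(ℝ, ℝ) (𝓡 2) ∞ (fun t : ℝ => γ (t : Circ))

/-- The velocity of a closed curve at the parameter `θ`, read in the preferred chart at the point
`γ θ` (hence an element of the tangent space there). -/
def velocity (γ : C(Circ, S)) (θ : Circ) : Plane :=
  deriv (fun h : ℝ => chartAt Plane (γ θ) (γ (θ + (h : Circ)))) 0

/-- The determinant of the pair `(u, v)`; in an oriented chart the pair is a positively
oriented basis iff this is positive, and is linearly dependent iff this is zero. -/
def det₂ (u v : Plane) : ℝ := u 0 * v 1 - u 1 * v 0

/-- The sign of the intersection `γ φ = δ θ`: it is `1` if the pair of tangent vectors of `γ` and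
`δ` orients the tangent plane, and `-1` if it gives the opposite orientation. -/
def intersectionSign (γ δ : C(Circ, S)) (φ θ : Circ) : ℤ :=
  (SignType.sign (det₂ (velocity γ φ) (velocity δ θ)) : ℤ)

/-- The two closed curves are transverse wherever they meet. -/
def TransverseCurves (γ δ : C(Circ, S)) : Prop :=
  ∀ φ θ : Circ, γ φ = δ θ → det₂ (velocity γ φ) (velocity δ θ) ≠ 0

/-- The signed number of intersections of `γ` with `δ` (a finite sum for transverse curves). -/
def signedCount (γ δ : C(Circ, S)) : ℤ :=
  ∑ᶠ p ∈ {p : Circ × Circ | γ p.1 = δ p.2}, intersectionSign γ δ p.1 p.2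

end Curves

/-- An oriented knot diagram on `S`: an immersed closed curve whose only multiple points are
finitely many transverse double points, at each of which one of the two branches is declared to be
the over-branch.  A crossing is recorded as the pair (over-parameter, under-parameter). -/
structure KnotDiagram (S : Type*) [TopologicalSpace S] [ChartedSpace Plane S] where
  curve : C(Circ, S)
  smooth : SmoothCurve curve
  immersed : ∀ θ, velocity curve θ ≠ 0
  crossings : Set (Circ × Circ)
  finite_crossings : crossings.Finite
  ne_of_mem : ∀ p ∈ crossings, p.1 ≠ p.2
  eq_of_mem : ∀ p ∈ crossings, curve p.1 = curve p.2
  transverse_of_mem : ∀ p ∈ crossings, det₂ (velocity curve p.1) (velocity curve p.2) ≠ 0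
  over_or_under : ∀ θ φ, θ ≠ φ → curve θ = curve φ →
    Xor ((θ, φ) ∈ crossings) ((φ, θ) ∈ crossings)
  no_triple : ∀ θ φ ψ, curve θ = curve φ → curve φ = curve ψ → θ = φ ∨ φ = ψ ∨ θ = ψ

namespace KnotDiagram

variable {S : Type*} [TopologicalSpace S] [ChartedSpace Plane S]

/-- The set `C(D)` of crossing points. -/
abbrev Crossing (D : KnotDiagram S) : Type := ↥D.crossings

/-- The parameter at which the curve runs through the crossing along the over-arc. -/
def Crossing.over {D : KnotDiagram S} (c : D.Crossing) : Circ := c.1.1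

/-- The parameter at which the curve runs through the crossing along the under-arc. -/
def Crossing.under {D : KnotDiagram S} (c : D.Crossing) : Circ := c.1.2

/-- The point of the surface where the crossing sits. -/
def Crossing.point {D : KnotDiagram S} (c : D.Crossing) : S := D.curve (Crossing.over c)

/-- `γ` is smooth, meets `D` transversally, and avoids the crossings of `D`. -/
structure GeneralPosition (γ : C(Circ, S)) (D : KnotDiagram S) : Prop where
  smooth : SmoothCurve γ
  transverse : TransverseCurves γ D.curve
  avoids : ∀ c : D.Crossing, c.point ∉ Set.range γ

/-- The algebraic intersection number `[γ] · [D]` is `n`: the signed count of intersections is `n`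
after moving `γ` by a homotopy into general position with respect to `D`. -/
def HasIntersectionNumber (γ : C(Circ, S)) (D : KnotDiagram S) (n : ℤ) : Prop :=
  ∃ γ₁ : C(Circ, S), γ.Homotopic γ₁ ∧ GeneralPosition γ₁ D ∧ signedCount γ₁ D.curve = n

/-- The total sign of the intersections with `γ` that `D` meets at the parameter `θ`
(zero if `D` does not meet `γ` there). -/
def jump (γ : C(Circ, S)) (D : KnotDiagram S) (θ : Circ) : ℤ :=
  ∑ᶠ φ ∈ {φ : Circ | γ φ = D.curve θ}, intersectionSign γ D.curve φ θ

/-- `col` is a coloring of `D` with respect to `γ`: it is constant along the parts into which `γ`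
divides `D`, and walking along `D` through an intersection with `γ` adds the sign of the
intersection.  (The values at the intersection points themselves play no role.) -/
def IsColoring (γ : C(Circ, S)) (D : KnotDiagram S) (col : Circ → ℤ) : Prop :=
  ∀ θ : Circ, ∃ a : ℤ,
    (∀ᶠ h : ℝ in 𝓝[>] 0, col (θ - (h : Circ)) = a ∧ col (θ + (h : Circ)) = a + jump γ D θ) ∧
    (D.curve θ ∉ Set.range γ → col θ = a)

/-- `f` is the assignment `f_γ` on the crossings of `D`: move `γ` by a homotopy into general
position, color `D`, and subtract the color of the under-arc from that of the over-arc. -/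
def IsIndexOf (γ : C(Circ, S)) (D : KnotDiagram S) (f : D.Crossing → ℤ) : Prop :=
  ∃ γ₁ : C(Circ, S), γ.Homotopic γ₁ ∧ GeneralPosition γ₁ D ∧
    ∃ col : Circ → ℤ, IsColoring γ₁ D col ∧ ∀ c : D.Crossing, f c = col c.over - col c.under

/-- `D` and `D'` are the same diagram, up to an orientation preserving reparametrization, outside
a closed disk of the surface, and both meet the disk in `k` corresponding arcs. -/
structure LocalMove (D D' : KnotDiagram S) (k : ℕ) where
  /-- A topological chart around the disk. -/
  chart : OpenPartialHomeomorph S Plane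
  ball_subset : Metric.closedBall (0 : Plane) 1 ⊆ chart.target
  /-- The change of parameter. -/
  reparam : Circ ≃ₜ Circ
  reparam_smooth : ∃ g : ℝ → ℝ, ContDiff ℝ ∞ g ∧ (∀ t, 0 < deriv g t) ∧
    ∀ t : ℝ, reparam (t : Circ) = (g t : Circ)
  /-- The arcs of `D` in the disk, as closed arcs `[left i, right i]` of parameters. -/
  left : Fin k → ℝ
  right : Fin k → ℝ
  left_lt_right : ∀ i, left i < right i
  right_lt : ∀ i, right i < left i + 1
  disjoint_arcs : ∀ i j, i ≠ j →
    Disjoint ((fun t : ℝ => (t : Circ)) '' Set.Icc (left i) (right i))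
      ((fun t : ℝ => (t : Circ)) '' Set.Icc (left j) (right j))
  mem_disk_iff : ∀ θ, D.curve θ ∈ chart.symm '' Metric.closedBall (0 : Plane) 1 ↔
    ∃ i, θ ∈ (fun t : ℝ => (t : Circ)) '' Set.Icc (left i) (right i)
  mem_disk_iff' : ∀ θ, D'.curve (reparam θ) ∈ chart.symm '' Metric.closedBall (0 : Plane) 1 ↔
    ∃ i, θ ∈ (fun t : ℝ => (t : Circ)) '' Set.Icc (left i) (right i)
  curve_eq : ∀ θ, D.curve θ ∉ chart.symm '' Metric.closedBall (0 : Plane) 1 →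
    D'.curve (reparam θ) = D.curve θ
  crossings_iff : ∀ θ φ, D.curve θ ∉ chart.symm '' Metric.closedBall (0 : Plane) 1 →
    D.curve φ ∉ chart.symm '' Metric.closedBall (0 : Plane) 1 →
    ((reparam θ, reparam φ) ∈ D'.crossings ↔ (θ, φ) ∈ D.crossings)

namespace LocalMove

variable {D D' : KnotDiagram S} {k : ℕ}

/-- The closed disk in which the move takes place. -/
def disk (m : LocalMove D D' k) : Set S := m.chart.symm '' Metric.closedBall (0 : Plane) 1

/-- The parameters of the `i`-th arc of `D` in the disk. -/
def arc (m : LocalMove D D' k) (i : Fin k) : Set Circ :=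
  (fun t : ℝ => (t : Circ)) '' Set.Icc (m.left i) (m.right i)

/-- The parameters of the corresponding arc of `D'` in the disk. -/
def arc' (m : LocalMove D D' k) (i : Fin k) : Set Circ := m.reparam '' m.arc i

/-- First Reidemeister move: an arc without crossings is replaced with an arc which has exactly
one crossing (with itself). -/
def IsR1 (m : LocalMove D D' 1) : Prop :=
  (∀ c : D.Crossing, c.point ∉ m.disk) ∧ ∃! c : D'.Crossing, c.point ∈ m.disk

/-- Second Reidemeister move: two arcs without crossings are replaced with two arcs that cross
each other exactly twice, the arc `0` being above the arc `1` both times, and have no other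
crossings in the disk. -/
def IsR2 (m : LocalMove D D' 2) : Prop :=
  (∀ c : D.Crossing, c.point ∉ m.disk) ∧
  {c : D'.Crossing | c.point ∈ m.disk}.ncard = 2 ∧
  ∀ c : D'.Crossing, c.point ∈ m.disk → c.over ∈ m.arc' 0 ∧ c.under ∈ m.arc' 1

/-- Third Reidemeister move: in both diagrams the three arcs `0`, `1`, `2` in the disk (the top,
middle and bottom one) cross each other pairwise exactly once, the arc with the smaller label
being above, and there are no other crossings in the disk. -/
def IsR3 (m : LocalMove D D' 3) : Prop :=
  (∀ i j, i < j → ∃! c : D.Crossing, c.over ∈ m.arc i ∧ c.under ∈ m.arc j) ∧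
  (∀ i j, ¬ i < j → ¬ ∃ c : D.Crossing, c.over ∈ m.arc i ∧ c.under ∈ m.arc j) ∧
  (∀ i j, i < j → ∃! c : D'.Crossing, c.over ∈ m.arc' i ∧ c.under ∈ m.arc' j) ∧
  (∀ i j, ¬ i < j → ¬ ∃ c : D'.Crossing, c.over ∈ m.arc' i ∧ c.under ∈ m.arc' j)

end LocalMove

/-- The move is a Reidemeister move (of type I, II, or III, read from `D` to `D'`; the inverse
moves are obtained by reading it backwards). -/
inductive IsReidemeister : {D D' : KnotDiagram S} → {k : ℕ} → LocalMove D D' k → Prop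
  | r1 {D D' : KnotDiagram S} (m : LocalMove D D' 1) : m.IsR1 → IsReidemeister m
  | r2 {D D' : KnotDiagram S} (m : LocalMove D D' 2) : m.IsR2 → IsReidemeister m
  | r3 {D D' : KnotDiagram S} (m : LocalMove D D' 3) : m.IsR3 → IsReidemeister m

/-- The chord index axioms, for integers `f D c` assigned to the crossings `c` of the diagrams `D`
in the class `𝒟`. -/
structure IsChordIndex (𝒟 : Set (KnotDiagram S)) (f : (D : KnotDiagram S) → D.Crossing → ℤ) :
    Prop where
  /-- The crossing involved in a first Reidemeister move has index zero. -/
  axiom₁ : ∀ D ∈ 𝒟, ∀ D' ∈ 𝒟, ∀ m : LocalMove D D' 1, m.IsR1 →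
    ∀ c : D'.Crossing, c.point ∈ m.disk → f D' c = 0
  /-- The two crossings involved in a second Reidemeister move have the same index. -/
  axiom₂ : ∀ D ∈ 𝒟, ∀ D' ∈ 𝒟, ∀ m : LocalMove D D' 2, m.IsR2 →
    ∀ c₁ c₂ : D'.Crossing, c₁.point ∈ m.disk → c₂.point ∈ m.disk → f D' c₁ = f D' c₂
  /-- The indices of the three crossings involved in a third Reidemeister move are preserved. -/
  axiom₃ : ∀ D ∈ 𝒟, ∀ D' ∈ 𝒟, ∀ m : LocalMove D D' 3, m.IsR3 →
    ∀ (i j : Fin 3) (c : D.Crossing) (c' : D'.Crossing),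
      c.over ∈ m.arc i → c.under ∈ m.arc j → c'.over ∈ m.arc' i → c'.under ∈ m.arc' j →
      f D' c' = f D c
  /-- The index of a crossing that is not involved in a Reidemeister move is preserved. -/
  axiom₄ : ∀ D ∈ 𝒟, ∀ D' ∈ 𝒟, ∀ (k : ℕ) (m : LocalMove D D' k), IsReidemeister m →
    ∀ (c : D.Crossing) (c' : D'.Crossing), c.point ∉ m.disk →
      c'.over = m.reparam c.over → c'.under = m.reparam c.under → f D' c' = f D c

end KnotDiagram

end

/-! The signed number of intersections of `γ` with an oriented loop is the value on `γ` of the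
integral cohomology class dual to that loop, and such a class can be represented by a map from the
surface to the circle `ℝ / ℤ`. Concretely, near each point `q` count, for nearby `y`, the strands of
the loop through `q` that have `y` on their right. These germs agree up to additive constants
(`Coherent`). A partition of unity glues them to a real function `u` with the same jumps
(`Coherent.exists_isPotential`), and `u` mod 1 is continuous. If `L` is a continuous lift of `u ∘ γ`
mod 1, the integer function `u ∘ γ - L` jumps by the sign of each intersection. Hence the signed
count is minus the degree of `u ∘ γ` mod 1 (`finsum_strandJump_eq_degree`), a homotopy invariant.

For a crossing `c`, the difference of colors is the sum of the jumps along the part of `D` from the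
under-parameter to the over-parameter. This part closes up at `c` to a loop with one corner, where
the indicator of the sector on the right serves as germ (`coherent_cornerSum`). So `f_γ(c)` is minus
a degree that mentions neither the coloring nor the moved curve (`IsIndexOf.eq_degree`). Colorings
exist because the jumps along `D` add up to `[γ] · [D] = 0` (`exists_jump_primitive`).

A Reidemeister move alters these loops only inside a disk. If two families of germs agree up to
constants off a disk, the difference of their potentials is a real lift, continuous off the disk, of
a continuous circle valued map. This lift can be corrected inside the disk, which is simply
connected with a connected collar, so the degrees are equal (`circleDegree_eq_of_eq_off_disk`). In
the first move the loop of the crossing lies in the disk, like the empty loop off it. In the second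
move the loops of the two crossings agree off the disk. In the third move, and for uninvolved
crossings, the loops before and after agree off the disk. -/

noncomputable section

open Filter Set

/-! ### Integer valued functions on the line with isolated jumps -/

/-- An integer valued function on the line which is locally constant on both sides of each point `t`
and jumps there by `J t`. -/
def HasJumps (K J : ℝ → ℤ) : Prop :=
  ∀ t, ∃ a, ∀ᶠ h : ℝ in 𝓝[>] 0, K (t - h) = a ∧ K (t + h) = a + J t

theorem eventually_nhdsGT_zero_iff {p : ℝ → Prop} :
    (∀ᶠ h in 𝓝[>] (0 : ℝ), p h) ↔ ∃ ε > 0, ∀ h, 0 < h → h < ε → p h := by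
  rw [eventually_iff, mem_nhdsGT_iff_exists_Ioo_subset]
  constructor
  · rintro ⟨ε, hε, h⟩
    exact ⟨ε, hε, fun x h0 h1 => h ⟨h0, h1⟩⟩
  · rintro ⟨ε, hε, h⟩
    exact ⟨ε, hε, fun x hx => h x hx.1 hx.2⟩

/-- An infinite subset of a compact set accumulates somewhere. The finiteness of jumps, of fibers
and of intersections all comes from here. -/
theorem finite_of_isCompact_of_isolated {X : Type*} [TopologicalSpace X] {k s : Set X}
    (hk : IsCompact k) (h : ∀ x ∈ k, ∀ᶠ y in 𝓝[≠] x, y ∉ s) : (s ∩ k).Finite := by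
  by_contra hinf
  obtain ⟨x, hx, hacc⟩ :=
    Set.Infinite.exists_accPt_of_subset_isCompact hinf hk inter_subset_right
  rw [accPt_iff_frequently_nhdsNE] at hacc
  exact hacc ((h x hx).mono fun y hy hy' => hy hy'.1)

namespace HasJumps

variable {K J : ℝ → ℤ}

theorem exists_eps (hK : HasJumps K J) (t : ℝ) : ∃ a, ∃ ε > 0,
    (∀ s, t - ε < s → s < t → K s = a) ∧ ∀ s, t < s → s < t + ε → K s = a + J t := by
  obtain ⟨a, ha⟩ := hK t
  obtain ⟨ε, hε, h⟩ := eventually_nhdsGT_zero_iff.1 ha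
  refine ⟨a, ε, hε, fun s h1 h2 => ?_, fun s h1 h2 => ?_⟩
  · simpa using (h (t - s) (by linarith) (by linarith)).1
  · simpa using (h (s - t) (by linarith) (by linarith)).2

theorem eq_zero_of_const (hK : HasJumps K J) {t : ℝ} {c : ℤ} {u v : ℝ}
    (h : ∀ s, u < s → s < v → K s = c) (hu : u < t) (hv : t < v) : J t = 0 := by
  obtain ⟨a, ε, hε, h1, h2⟩ := hK.exists_eps t
  set δ := min ε (min (t - u) (v - t)) / 2 with hδ
  have h3 : 0 < min ε (min (t - u) (v - t)) := by
    refine lt_min hε (lt_min ?_ ?_) <;> linarith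
  have h4 : min ε (min (t - u) (v - t)) ≤ ε := min_le_left _ _
  have h5 : min ε (min (t - u) (v - t)) ≤ t - u := (min_le_right _ _).trans (min_le_left _ _)
  have h6 : min ε (min (t - u) (v - t)) ≤ v - t := (min_le_right _ _).trans (min_le_right _ _)
  have e1 := h1 (t - δ) (by linarith) (by linarith)
  have e2 := h2 (t + δ) (by linarith) (by linarith)
  rw [h _ (by linarith) (by linarith)] at e1 e2
  omega

theorem eventually_eq_zero (hK : HasJumps K J) (t : ℝ) : ∀ᶠ s in 𝓝[≠] t, J s = 0 := by
  obtain ⟨a, ε, hε, h1, h2⟩ := hK.exists_eps t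
  rw [eventually_nhdsWithin_iff]
  filter_upwards [Ioo_mem_nhds (show t - ε < t by linarith) (show t < t + ε by linarith)]
    with s hs hne
  rcases lt_or_gt_of_ne hne with h | h
  · exact hK.eq_zero_of_const h1 hs.1 h
  · exact hK.eq_zero_of_const h2 h hs.2

theorem finite_support_inter (hK : HasJumps K J) (x y : ℝ) :
    (Function.support J ∩ Icc x y).Finite :=
  finite_of_isCompact_of_isolated isCompact_Icc fun t _ =>
    (hK.eventually_eq_zero t).mono fun s hs => by simpa using hs

/-- The right limit of `K` minus the jumps accumulated since `x` is locally constant on `[x, ∞)`,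
hence constant. Using right limits is what makes the half open interval `Ioc` correct. -/
theorem sub_eq_finsum (hK : HasJumps K J) {x y : ℝ} (hxy : x ≤ y) {k l : ℤ}
    (hk : ∀ᶠ h in 𝓝[>] (0 : ℝ), K (x + h) = k) (hl : ∀ᶠ h in 𝓝[>] (0 : ℝ), K (y + h) = l) :
    l - k = ∑ᶠ t ∈ Ioc x y, J t := by
  have hr : ∀ t, ∃ r, ∀ᶠ h in 𝓝[>] (0 : ℝ), K (t + h) = r := fun t => by
    obtain ⟨a, ha⟩ := hK t
    exact ⟨_, ha.mono fun _ h => h.2⟩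
  choose r hr using hr
  have runi : ∀ t l, (∀ᶠ h in 𝓝[>] (0 : ℝ), K (t + h) = l) → r t = l := fun t l h => by
    obtain ⟨s, h1, h2⟩ := ((hr t).and h).exists
    rw [← h1, h2]
  have hsupp : ∀ u v : ℝ, (Function.support J ∩ Ioc u v).Finite := fun u v =>
    (hK.finite_support_inter u v).subset (inter_subset_inter_right _ Ioc_subset_Icc_self)
  have rconst : ∀ {u v : ℝ} {c : ℤ}, (∀ s, u < s → s < v → K s = c) → ∀ s, u ≤ s → s < v →
      r s = c := fun {u v c} h s h1 h2 => by
    refine runi s c (eventually_nhdsGT_zero_iff.2 ⟨v - s, by linarith, fun h' h3 h4 => ?_⟩)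
    exact h _ (by linarith) (by linarith)
  set f : ℝ → ℤ := fun t => r t - ∑ᶠ s ∈ Ioc x t, J s with hf
  have hadd : ∀ {u v : ℝ}, x ≤ u → u ≤ v →
      ∑ᶠ s ∈ Ioc x v, J s = ∑ᶠ s ∈ Ioc x u, J s + ∑ᶠ s ∈ Ioc u v, J s := fun {u v} h1 h2 => by
    rw [← Ioc_union_Ioc_eq_Ioc h1 h2, finsum_mem_union' _ (by simpa [inter_comm] using hsupp x u)
      (by simpa [inter_comm] using hsupp u v)]
    exact Ioc_disjoint_Ioc_of_le le_rfl
  have hcont : ContinuousOn f (Ici x) := by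
    intro t ht
    have ht : x ≤ t := ht
    apply ContinuousWithinAt.congr_of_eventuallyEq (f := fun _ => f t) continuousWithinAt_const _ rfl
    obtain ⟨a, ε, hε, h1, h2⟩ := hK.exists_eps t
    filter_upwards [self_mem_nhdsWithin, mem_nhdsWithin_of_mem_nhds
      (Ioo_mem_nhds (show t - ε < t by linarith) (show t < t + ε by linarith))] with s hxs hs
    have hxs : x ≤ s := hxs
    have hrt : r t = a + J t := rconst h2 t le_rfl (by linarith)
    rcases lt_trichotomy s t with h | h | h
    · have hrs : r s = a := rconst h1 s hs.1.le h
      have : ∑ᶠ s' ∈ Ioc s t, J s' = J t := by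
        rw [finsum_eq_single _ t]
        · simp [h]
        · intro s' hne
          by_cases h7 : s' ∈ Ioc s t
          · simp [h7, hK.eq_zero_of_const h1 (hs.1.trans h7.1) (lt_of_le_of_ne h7.2 hne)]
          · simp [h7]
      simp only [hf, hadd hxs h.le, this, hrs, hrt]
      ring
    · rw [h]
    · have hrs : r s = a + J t := rconst h2 s h.le hs.2
      have : ∑ᶠ s' ∈ Ioc t s, J s' = 0 := by
        apply finsum_mem_eq_zero_of_forall_eq_zero
        intro s' hs'
        exact hK.eq_zero_of_const h2 hs'.1 (hs'.2.trans_lt hs.2)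
      simp only [hf, hadd ht h.le, this, hrs, hrt]
      ring
  have := isPreconnected_Ici.constant hcont (show x ∈ Ici x from mem_Ici.2 le_rfl) (show y ∈ Ici x from hxy)
  simp only [hf, runi x k hk, runi y l hl, Ioc_self, finsum_mem_empty] at this
  omega

end HasJumps

/-! ### Functions on the circle with prescribed jumps -/

theorem coe_injOn_Ioc (x : ℝ) : InjOn (fun t : ℝ => (t : Circ)) (Ioc x (x + 1)) := by
  intro s hs t ht h
  exact (AddCircle.coe_eq_coe_iff_of_mem_Ioc (p := (1 : ℝ)) hs ht).1 h

theorem coe_surjOn_Ioc (x : ℝ) : (fun t : ℝ => (t : Circ)) '' Ioc x (x + 1) = univ :=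
  AddCircle.coe_image_Ioc_eq (p := (1 : ℝ)) x

/-- A finitely supported function on the circle of total sum zero is the jump function of an
integer valued function on the circle. -/
theorem exists_jump_primitive (J : Circ → ℤ) (hfin : (Function.support J).Finite)
    (hsum : ∑ᶠ θ, J θ = 0) :
    ∃ col : Circ → ℤ, ∀ θ : Circ, ∃ a : ℤ,
      (∀ᶠ h : ℝ in 𝓝[>] 0, col (θ - (h : Circ)) = a ∧ col (θ + (h : Circ)) = a + J θ) ∧
      (J θ = 0 → col θ = a) := by
  classical
  set rep : Circ → ℝ := fun θ => (AddCircle.equivIco (1 : ℝ) 0 θ : ℝ) with hrep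
  have rep_mem : ∀ θ, 0 ≤ rep θ ∧ rep θ < 1 := fun θ => by
    have := (AddCircle.equivIco (1 : ℝ) 0 θ).2
    simpa using this
  have coe_rep : ∀ θ, ((rep θ : ℝ) : Circ) = θ := fun θ =>
    (AddCircle.equivIco (1 : ℝ) 0).symm_apply_apply θ
  have rep_coe : ∀ t : ℝ, 0 ≤ t → t < 1 → rep (t : Circ) = t := fun t h0 h1 => by
    refine (AddCircle.coe_eq_coe_iff_of_mem_Ico (p := (1 : ℝ)) (a := 0) ?_ ?_).1 (coe_rep t)
    · simpa using rep_mem _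
    · simpa using ⟨h0, h1⟩
  have rep_inj : Function.Injective rep := fun θ φ h => by rw [← coe_rep θ, h, coe_rep]
  set T : Finset Circ := hfin.toFinset with hT
  -- The coloring is the cumulative sum of the jumps, starting at the base point `0` of the circle.
  set C : ℝ → ℤ := fun t => ∑ θ ∈ T with rep θ ≤ t, J θ with hC
  have hsum' : ∑ θ ∈ T, J θ = 0 := by
    rw [← hsum, finsum_eq_sum_of_support_subset]
    simp [hT]
  have hCneg : ∀ t < 0, C t = 0 := fun t ht => by
    simp only [hC]
    rw [Finset.filter_false_of_mem, Finset.sum_empty]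
    intro θ _
    linarith [(rep_mem θ).1]
  -- All jumps occur in `[0, M]` with `M < 1`. As they total zero, `C` vanishes beyond `M` just as
  -- it does to the left of `0`, so no spurious jump arises at the base point.
  obtain ⟨M, hM1, hM⟩ : ∃ M < (1 : ℝ), ∀ θ ∈ T, rep θ ≤ M := by
    by_cases hne : (T.image rep).Nonempty
    · refine ⟨(T.image rep).max' hne, ?_, fun θ hθ => Finset.le_max' _ _
        (Finset.mem_image_of_mem _ hθ)⟩
      obtain ⟨θ, _, h⟩ := Finset.mem_image.1 (Finset.max'_mem _ hne)
      rw [← h]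
      exact (rep_mem θ).2
    · refine ⟨0, one_pos, fun θ hθ => absurd ⟨_, Finset.mem_image_of_mem _ hθ⟩ hne⟩
  have hClarge : ∀ t, M ≤ t → C t = 0 := fun t ht => by
    simp only [hC]
    rw [Finset.filter_true_of_mem, hsum']
    intro θ hθ
    exact (hM θ hθ).trans ht
  have hcol : ∀ t : ℝ, M - 1 ≤ t → t < 1 → C (rep t) = C t := fun t h1 h2 => by
    rcases le_or_gt 0 t with h | h
    · rw [rep_coe t h h2]
    · have : ((t : ℝ) : Circ) = ((t + 1 : ℝ) : Circ) := by
        rw [AddCircle.coe_add, AddCircle.coe_period, add_zero]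
      by_cases h0 : 0 ≤ t + 1
      · rw [this, rep_coe _ h0 (by linarith), hClarge _ (by linarith), hCneg t h]
      · have : T = ∅ := by
          rw [Finset.eq_empty_iff_forall_notMem]
          intro θ hθ
          linarith [hM θ hθ, (rep_mem θ).1]
        simp [hC, this]
  refine ⟨fun θ => C (rep θ), fun θ => ?_⟩
  set x := rep θ with hx
  have hx0 := (rep_mem θ).1
  have hx1 := (rep_mem θ).2
  have hθ : θ = ((x : ℝ) : Circ) := (coe_rep θ).symm
  have hsplit : C x = ∑ φ ∈ T with rep φ < x, J φ + J θ := by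
    simp only [hC]
    have : (T.filter fun φ => rep φ ≤ x) = (T.filter fun φ => rep φ < x) ∪ T.filter fun φ => φ = θ := by
      ext φ
      simp only [Finset.mem_filter, Finset.mem_union, le_iff_lt_or_eq, ← and_or_left, hx,
        rep_inj.eq_iff]
    rw [this, Finset.sum_union]
    · congr 1
      rw [Finset.filter_eq']
      split_ifs with h
      · simp
      · simp only [Finset.sum_empty]
        simpa [hT, eq_comm] using h
    · rw [Finset.disjoint_filter]
      rintro φ _ h1 rfl
      exact lt_irrefl _ h1
  refine ⟨∑ φ ∈ T with rep φ < x, J φ, ?_, fun h0 => ?_⟩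
  · have e0 : ∀ᶠ h : ℝ in 𝓝[>] 0, 0 < h := eventually_mem_nhdsWithin
    have e1 : ∀ᶠ h : ℝ in 𝓝[>] 0, h < 1 - x ∧ h < 1 - M :=
      mem_nhdsWithin_of_mem_nhds (((gt_mem_nhds (by linarith)).and (gt_mem_nhds (by linarith))))
    have e2 : ∀ᶠ h : ℝ in 𝓝[>] 0, ∀ φ ∈ T, (rep φ ≤ x - h ↔ rep φ < x) ∧
        (rep φ ≤ x + h ↔ rep φ ≤ x) := by
      rw [eventually_all_finset]
      intro φ _
      rcases lt_trichotomy (rep φ) x with h | h | h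
      · filter_upwards [e0, mem_nhdsWithin_of_mem_nhds (gt_mem_nhds (show 0 < x - rep φ by linarith))]
          with s h0 h1
        have : s < x - rep φ := h1
        constructor <;> constructor <;> intro <;> linarith
      · filter_upwards [e0] with s h0
        constructor <;> constructor <;> intro <;> linarith
      · filter_upwards [e0, mem_nhdsWithin_of_mem_nhds (gt_mem_nhds (show 0 < rep φ - x by linarith))]
          with s h0 h1
        have : s < rep φ - x := h1
        constructor <;> constructor <;> intro <;> linarith
    filter_upwards [e0, e1, e2] with h h0 h1 h2
    rw [hθ, ← AddCircle.coe_sub, ← AddCircle.coe_add, hcol _ (by linarith) (by linarith),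
      hcol _ (by linarith) (by linarith), ← hθ, ← hsplit]
    simp only [hC]
    exact ⟨by rw [Finset.filter_congr fun φ hφ => (h2 φ hφ).1],
      by rw [Finset.filter_congr fun φ hφ => (h2 φ hφ).2]⟩
  · change C x = _
    rw [hsplit, h0, add_zero]

/-! ### Germs of jump functions and circle valued maps -/

section Coherent

variable {S : Type*} [TopologicalSpace S]

/-- Two integer valued functions differ by a constant near a point. -/
def EqUpToConst (x : S) (g g' : S → ℤ) : Prop := ∃ c : ℤ, ∀ᶠ y in 𝓝 x, g y = c + g' y

/-- A family of germs of integer valued functions, one at each point, such that the germ at `x` also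
represents, up to constants, the germs at all points near `x`. -/
def Coherent (g : S → S → ℤ) : Prop := ∀ x, ∀ᶠ q in 𝓝 x, EqUpToConst q (g x) (g q)

/-- `u` is a real valued function with the same discontinuities as the germs `g`. -/
def IsPotential (u : S → ℝ) (g : S → S → ℤ) : Prop :=
  ∀ q, ContinuousAt (fun y => u y - g q y) q

/-- The potential is the average of the germs under a partition of unity. Since the weights sum to
one, subtracting the germ at `q` leaves the weighted sum of the differences of germs, and near `q`
each difference is constant wherever its weight matters. -/
theorem Coherent.exists_isPotential [CompactSpace S] [T2Space S] {g : S → S → ℤ}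
    (hg : Coherent g) : ∃ u, IsPotential u g := by
  set U : S → Set S := fun x => interior {q | EqUpToConst q (g x) (g q)} with hU
  obtain ⟨ρ, hρ⟩ := PartitionOfUnity.exists_isSubordinate isClosed_univ U
    (fun _ => isOpen_interior) fun x _ => mem_iUnion.2 ⟨x, mem_interior_iff_mem_nhds.2 (hg x)⟩
  refine ⟨fun y => ∑ᶠ i, ρ i y * g i y, fun q => ?_⟩
  obtain ⟨I, hI⟩ := ρ.exists_finset_nhds q
  have hterm : ∀ i ∈ I, ContinuousAt (fun y => ρ i y * ((g i y : ℝ) - g q y)) q := by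
    intro i _
    by_cases hq : q ∈ U i
    · obtain ⟨c, hc⟩ := interior_subset hq
      refine ((ρ i).continuous.continuousAt.mul (continuousAt_const (y := (c : ℝ)))).congr ?_
      filter_upwards [hc] with y hy
      simp only [Pi.mul_apply, hy]
      push_cast
      ring
    -- Here the germ at `i` need not be related to the one at `q`, but the weight vanishes near `q`.
    · refine (continuousAt_const (y := (0 : ℝ))).congr ?_
      have : q ∉ tsupport (ρ i) := fun h => hq (hρ i h)
      filter_upwards [(notMem_tsupport_iff_eventuallyEq.1 this)] with y hy
      simp only [hy, Pi.zero_apply, zero_mul]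
  have hsum : ContinuousAt (fun y => ∑ i ∈ I, ρ i y * ((g i y : ℝ) - g q y)) q :=
    tendsto_finsetSum I hterm
  refine hsum.congr ?_
  filter_upwards [hI] with y hy
  rw [finsum_eq_sum_of_support_subset (s := I)]
  · calc _ = ∑ i ∈ I, ρ i y * (g i y : ℝ) - (∑ i ∈ I, ρ i y) * g q y := by
          rw [Finset.sum_mul, ← Finset.sum_sub_distrib]
          exact Finset.sum_congr rfl fun i _ => by ring
      _ = _ := by rw [hy.1, one_mul]
  · refine Subset.trans (fun i hi => ?_) hy.2
    simp only [Function.mem_support] at hi ⊢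
    exact left_ne_zero_of_mul hi

theorem coe_int_eq_zero (n : ℤ) : ((n : ℝ) : Circ) = 0 := by
  simp

theorem exists_int_of_coe_eq_zero {x : ℝ} (h : (x : Circ) = 0) : ∃ n : ℤ, x = n := by
  obtain ⟨n, hn⟩ := (AddCircle.coe_eq_zero_iff (1 : ℝ)).1 h
  exact ⟨n, by simpa using hn.symm⟩

/-- The jumps of a potential are those of integer valued functions and disappear modulo 1. -/
theorem IsPotential.continuous_coe {u : S → ℝ} {g : S → S → ℤ} (hu : IsPotential u g) :
    Continuous fun x => (u x : Circ) := by
  rw [continuous_iff_continuousAt]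
  intro q
  have h : ContinuousAt (fun y => ((u y - g q y : ℝ) : Circ)) q :=
    (AddCircle.continuous_mk' (1 : ℝ)).continuousAt.comp (hu q)
  refine h.congr (Eventually.of_forall fun y => ?_)
  change ((u y - g q y : ℝ) : Circ) = _
  rw [AddCircle.coe_sub, coe_int_eq_zero, sub_zero]

/-- The circle valued function given by a potential. -/
def IsPotential.toCircle {u : S → ℝ} {g : S → S → ℤ} (hu : IsPotential u g) : C(S, Circ) :=
  ⟨_, hu.continuous_coe⟩

@[simp] theorem IsPotential.toCircle_apply {u : S → ℝ} {g : S → S → ℤ} (hu : IsPotential u g)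
    (x : S) : hu.toCircle x = (u x : Circ) := rfl

theorem exists_int_const_of_coe_eq_zero {s : Set S} (hs : IsPreconnected s) {M : S → ℝ}
    (hM : ContinuousOn M s) (h0 : ∀ x ∈ s, (M x : Circ) = 0) :
    ∃ n : ℤ, ∀ x ∈ s, M x = n := by
  have hd : IsDiscrete (range ((↑) : ℤ → ℝ)) :=
    (Int.isClosedEmbedding_coe_real.isEmbedding.isDiscrete_range)
  obtain ⟨y, ⟨n, rfl⟩, h⟩ := hs.eqOn_const_of_mapsTo (T := range ((↑) : ℤ → ℝ)) hd hM
    (fun x hx => by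
      obtain ⟨n, hn⟩ := exists_int_of_coe_eq_zero (h0 x hx)
      exact ⟨n, hn.symm⟩) ⟨_, 0, rfl⟩
  exact ⟨n, fun x hx => h hx⟩

end Coherent

/-! ### The degree of a circle map -/

section Degree

/-- A lift of a map from the circle to itself to the line. -/
def IsLift (L : ℝ → ℝ) (G : C(Circ, Circ)) : Prop :=
  Continuous L ∧ ∀ t : ℝ, ((L t : ℝ) : Circ) = G (t : Circ)

theorem exists_isLift (G : C(Circ, Circ)) : ∃ L, IsLift L G := by
  set f : C(ℝ, Circ) := ⟨fun t => G (t : Circ), G.continuous.comp (AddCircle.continuous_mk' _)⟩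
  obtain ⟨e₀, he⟩ := QuotientAddGroup.mk_surjective (f 0)
  obtain ⟨F, ⟨-, h⟩, -⟩ :=
    (AddCircle.isCoveringMap_coe (1 : ℝ)).existsUnique_continuousMap_lifts f 0 e₀ he
  exact ⟨F, F.continuous, fun t => congrFun h t⟩

theorem IsLift.exists_eq_add {L L' : ℝ → ℝ} {G : C(Circ, Circ)} (h : IsLift L G)
    (h' : IsLift L' G) : ∃ n : ℤ, ∀ t, L t = L' t + n := by
  obtain ⟨n, hn⟩ := exists_int_const_of_coe_eq_zero isPreconnected_univ
    (M := fun t => L t - L' t) (h.1.sub h'.1).continuousOn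
    (fun t _ => by rw [AddCircle.coe_sub, h.2, h'.2, sub_self])
  exact ⟨n, fun t => by linarith [hn t (mem_univ t)]⟩

/-- The degree of a map from the circle to itself. -/
def circleDegree (G : C(Circ, Circ)) : ℝ :=
  (exists_isLift G).choose 1 - (exists_isLift G).choose 0

theorem IsLift.sub_eq_circleDegree {L : ℝ → ℝ} {G : C(Circ, Circ)} (h : IsLift L G) :
    L 1 - L 0 = circleDegree G := by
  obtain ⟨n, hn⟩ := h.exists_eq_add (exists_isLift G).choose_spec
  rw [hn, hn, circleDegree]
  ring

theorem IsLift.add_one {L : ℝ → ℝ} {G : C(Circ, Circ)} (h : IsLift L G) (t : ℝ) :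
    L (t + 1) = L t + circleDegree G := by
  have h' : IsLift (fun t => L (t + 1)) G := by
    refine ⟨h.1.comp (continuous_add_const 1), fun t => ?_⟩
    rw [h.2, AddCircle.coe_add, AddCircle.coe_period, add_zero]
  obtain ⟨n, hn⟩ := h'.exists_eq_add h
  have h0 := hn 0
  rw [← h.sub_eq_circleDegree, hn t]
  rw [zero_add] at h0
  linarith

/-- Lift the homotopy to the line. The increment of the lift over one period is an integer depending
continuously on the homotopy parameter. -/
theorem circleDegree_eq_of_homotopic {G G' : C(Circ, Circ)} (h : G.Homotopic G') :
    circleDegree G = circleDegree G' := by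
  obtain ⟨H⟩ := h
  obtain ⟨L, hL⟩ := exists_isLift G
  set H' : C(unitInterval × ℝ, Circ) := ⟨fun p => H (p.1, (p.2 : Circ)), H.continuous.comp
    (continuous_fst.prodMk ((AddCircle.continuous_mk' (1 : ℝ)).comp continuous_snd))⟩ with hH'
  have h0 : ∀ a, H' (0, a) = ((⟨L, hL.1⟩ : C(ℝ, ℝ)) a : Circ) := fun a => by
    simp [hH', hL.2]
  set M := (AddCircle.isCoveringMap_coe (1 : ℝ)).liftHomotopy H' ⟨L, hL.1⟩ h0 with hMdef
  have hM : ∀ p, ((M p : ℝ) : Circ) = H' p := fun p =>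
    congrFun ((AddCircle.isCoveringMap_coe (1 : ℝ)).liftHomotopy_lifts H' ⟨L, hL.1⟩ h0) p
  have e0 : IsLift (fun t => M (0, t)) G :=
    ⟨M.continuous.comp (by fun_prop), fun t => by rw [hM]; simp [hH']⟩
  have e1 : IsLift (fun t => M (1, t)) G' :=
    ⟨M.continuous.comp (by fun_prop), fun t => by rw [hM]; simp [hH']⟩
  obtain ⟨n, hn⟩ := exists_int_const_of_coe_eq_zero (isPreconnected_univ (α := unitInterval))
    (M := fun s => M (s, 1) - M (s, 0))
    (Continuous.continuousOn (by fun_prop)) fun s _ => by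
      rw [AddCircle.coe_sub, hM, hM]
      simp only [hH', ContinuousMap.coe_mk, AddCircle.coe_period, AddCircle.coe_zero, sub_self]
  rw [← e0.sub_eq_circleDegree, ← e1.sub_eq_circleDegree, hn 0 (mem_univ _), hn 1 (mem_univ _)]

/-- Adding a real function on the circle to a lift does not change its increment over a period. -/
theorem circleDegree_eq_of_sub_eq {G G' : C(Circ, Circ)} (M : C(Circ, ℝ))
    (h : ∀ θ, G θ = G' θ + (M θ : Circ)) : circleDegree G = circleDegree G' := by
  obtain ⟨L, hL⟩ := exists_isLift G'
  have hL' : IsLift (fun t => L t + M (t : Circ)) G := by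
    refine ⟨hL.1.add (M.continuous.comp (AddCircle.continuous_mk' _)), fun t => ?_⟩
    rw [h, AddCircle.coe_add, hL.2]
  rw [← hL.sub_eq_circleDegree, ← hL'.sub_eq_circleDegree]
  simp only [AddCircle.coe_period, AddCircle.coe_zero]
  ring

theorem circleDegree_comp_eq {S : Type*} [TopologicalSpace S] {u : S → ℝ} {g : S → S → ℤ} (hu : IsPotential u g)
    {γ γ₁ : C(Circ, S)} (h : γ.Homotopic γ₁) :
    circleDegree (hu.toCircle.comp γ₁) = circleDegree (hu.toCircle.comp γ) :=
  (circleDegree_eq_of_homotopic ((ContinuousMap.Homotopic.refl hu.toCircle).comp h)).symm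

end Degree

/-! ### Changing germs inside a disk -/

section Disk

variable {S : Type*} [TopologicalSpace S]

theorem isPreconnected_annulus (r : ℝ) : IsPreconnected {z : Plane | 1 < ‖z‖ ∧ ‖z‖ < r} := by
  have h1 : IsPreconnected (Metric.sphere (0 : Plane) 1) :=
    isPreconnected_sphere (by rw [← Module.finrank_eq_rank]; simp) 0 1
  have h2 : IsPreconnected (Ioo (1 : ℝ) r ×ˢ Metric.sphere (0 : Plane) 1) :=
    isPreconnected_Ioo.prod h1
  convert h2.image (fun p => p.1 • p.2) (by fun_prop) using 1
  ext z
  simp only [mem_ofPred_eq, mem_image, mem_prod, mem_Ioo, mem_sphere_zero_iff_norm, Prod.exists]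
  constructor
  · rintro ⟨hz1, hz2⟩
    refine ⟨‖z‖, ‖z‖⁻¹ • z, ⟨⟨hz1, hz2⟩, ?_⟩, ?_⟩
    · rw [norm_smul, norm_inv, norm_norm, inv_mul_cancel₀ (by linarith)]
    · rw [smul_smul, mul_inv_cancel₀ (by linarith), one_smul]
  · rintro ⟨t, w, ⟨⟨h1, h2⟩, hw⟩, rfl⟩
    rw [norm_smul, hw, mul_one, Real.norm_eq_abs, abs_of_pos (by linarith)]
    exact ⟨h1, h2⟩

theorem exists_lift_on_ball {r : ℝ} (hr : 0 < r) {G : Plane → Circ}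
    (hG : ContinuousOn G (Metric.ball 0 r)) :
    ∃ M : Plane → ℝ, ContinuousOn M (Metric.ball 0 r) ∧
      ∀ z ∈ Metric.ball (0 : Plane) r, (M z : Circ) = G z := by
  classical
  have : ContractibleSpace (Metric.ball (0 : Plane) r) :=
    (convex_ball _ _).contractibleSpace ⟨0, Metric.mem_ball_self hr⟩
  have : LocallyPathConnectedSpace (Metric.ball (0 : Plane) r) :=
    Metric.isOpen_ball.locallyPathConnectedSpace
  set a₀ : Metric.ball (0 : Plane) r := ⟨0, Metric.mem_ball_self hr⟩
  obtain ⟨e₀, he⟩ := QuotientAddGroup.mk_surjective ((Metric.ball (0 : Plane) r).domRestrict G a₀)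
  obtain ⟨F, ⟨-, h⟩, -⟩ := (AddCircle.isCoveringMap_coe (1 : ℝ)).existsUnique_continuousMap_lifts
    ⟨_, hG.domRestrict⟩ a₀ e₀ he
  refine ⟨fun z => if hz : z ∈ Metric.ball (0 : Plane) r then F ⟨z, hz⟩ else 0, ?_, fun z hz => ?_⟩
  · rw [continuousOn_iff_continuous_domRestrict]
    convert F.continuous
    ext z
    have hz := z.2
    simp [-Metric.mem_ball, hz]
  · have := congrFun h ⟨z, hz⟩
    simpa [hz] using this

/-- A circle valued map which lifts outside the closed unit disk of a chart lifts globally. -/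
theorem exists_lift_of_lift_off_disk [T2Space S] (e : OpenPartialHomeomorph S Plane)
    (he : Metric.closedBall (0 : Plane) 1 ⊆ e.target) (G : C(S, Circ)) (M₁ : S → ℝ)
    (hM₁ : ∀ x ∉ e.symm '' Metric.closedBall (0 : Plane) 1, ContinuousAt M₁ x)
    (hG₁ : ∀ x, (M₁ x : Circ) = G x) :
    ∃ M : C(S, ℝ), ∀ x, (M x : Circ) = G x := by
  classical
  set K := e.symm '' Metric.closedBall (0 : Plane) 1 with hK
  have hKclosed : IsClosed K :=
    ((isCompact_closedBall 0 1).image_of_continuousOn (e.continuousOn_symm.mono he)).isClosed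
  -- A slightly larger disk still lies in the chart. Its open collar around the unit disk is where
  -- the two lifts are compared.
  obtain ⟨δ, hδ, hsub⟩ := (isCompact_closedBall (0 : Plane) 1).exists_thickening_subset_open
    e.open_target he
  rw [thickening_closedBall hδ zero_le_one] at hsub
  set r := δ + 1 with hr
  have hr1 : 1 < r := by linarith
  obtain ⟨M₂, hM₂, hG₂⟩ := exists_lift_on_ball (r := r) (by linarith) (G := fun z => G (e.symm z))
    (G.continuous.comp_continuousOn (e.continuousOn_symm.mono hsub))
  set B := e.symm '' Metric.ball (0 : Plane) r with hB
  have hBopen : IsOpen B := e.isOpen_image_symm_of_subset_target Metric.isOpen_ball hsub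
  have hB' : ∀ x ∈ B, x ∈ e.source ∧ e x ∈ Metric.ball (0 : Plane) r := by
    rintro _ ⟨z, hz, rfl⟩
    exact ⟨e.map_target (hsub hz), by rwa [e.right_inv (hsub hz)]⟩
  have hM₂' : ∀ x ∈ B, ContinuousAt (fun x => M₂ (e x)) x := fun x hx =>
    ContinuousAt.comp (f := e) (hM₂.continuousAt (Metric.isOpen_ball.mem_nhds (hB' x hx).2))
      (e.continuousAt (hB' x hx).1)
  -- Connectedness of the collar gives a single integer `n`, and shifting the inner lift by it makes
  -- the two lifts match.
  obtain ⟨n, hn⟩ := exists_int_const_of_coe_eq_zero (isPreconnected_annulus r)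
    (M := fun z => M₁ (e.symm z) - M₂ z) (by
      intro z hz
      have hzr : z ∈ Metric.ball (0 : Plane) r := by simpa using hz.2
      have hzK : e.symm z ∉ K := by
        rintro ⟨w, hw, hwz⟩
        have := e.symm.injOn (he hw) (hsub hzr) hwz
        subst this
        have := mem_closedBall_zero_iff.1 hw
        linarith [hz.1]
      refine (ContinuousAt.sub ?_ ?_).continuousWithinAt
      · exact ContinuousAt.comp (g := M₁) (hM₁ _ hzK) (e.symm.continuousAt (hsub hzr))
      · exact hM₂.continuousAt (Metric.isOpen_ball.mem_nhds hzr))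
    (fun z hz => by
      have hzr : z ∈ Metric.ball (0 : Plane) r := by simpa using hz.2
      rw [AddCircle.coe_sub, hG₁, hG₂ z hzr, sub_self])
  set M : S → ℝ := fun x => if x ∈ K then M₂ (e x) + n else M₁ x with hM
  have hMB : ∀ x ∈ B, M x = M₂ (e x) + n := by
    intro x hx
    simp only [hM]
    split_ifs with hxK
    · rfl
    · obtain ⟨z, hz, rfl⟩ := hx
      have hz1 : 1 < ‖z‖ := by
        by_contra hc
        exact hxK ⟨z, by simpa using hc, rfl⟩
      have := hn z ⟨hz1, by simpa using hz⟩
      rw [e.right_inv (hsub hz)]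
      linarith
  have hKB : K ⊆ B := image_mono (Metric.closedBall_subset_ball hr1)
  refine ⟨⟨M, continuous_iff_continuousAt.2 fun x => ?_⟩, fun x => ?_⟩
  · by_cases hx : x ∈ K
    · refine ((hM₂' x (hKB hx)).add (continuousAt_const (y := (n : ℝ)))).congr ?_
      filter_upwards [hBopen.mem_nhds (hKB hx)] with y hy
      exact (hMB y hy).symm
    · refine (hM₁ x hx).congr ?_
      filter_upwards [hKclosed.isOpen_compl.mem_nhds hx] with y hy
      have : y ∉ K := hy
      simp [hM, this]
  · change ((M x : ℝ) : Circ) = G x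
    by_cases hx : x ∈ K
    · obtain ⟨z, hz, rfl⟩ := hKB hx
      rw [hMB _ ⟨z, hz, rfl⟩, e.right_inv (hsub hz), AddCircle.coe_add, coe_int_eq_zero, add_zero,
        hG₂ z hz]
    · simp [hM, hx, hG₁]

theorem EqUpToConst.continuousAt_sub {u u' : S → ℝ} {g g' : S → S → ℤ} (hu : IsPotential u g)
    (hu' : IsPotential u' g') {q : S} (h : EqUpToConst q (g q) (g' q)) :
    ContinuousAt (fun y => u y - u' y) q := by
  obtain ⟨c, hc⟩ := h
  refine (((hu q).sub (hu' q)).add (continuousAt_const (y := (c : ℝ)))).congr ?_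
  filter_upwards [hc] with y hy
  simp only [Pi.add_apply, Pi.sub_apply, hy]
  push_cast
  ring

/-- Germs which agree outside a disk have the same degree along every loop. -/
theorem circleDegree_eq_of_eq_off_disk [T2Space S] (e : OpenPartialHomeomorph S Plane)
    (he : Metric.closedBall (0 : Plane) 1 ⊆ e.target) {u u' : S → ℝ} {g g' : S → S → ℤ}
    (hu : IsPotential u g) (hu' : IsPotential u' g')
    (h : ∀ q ∉ e.symm '' Metric.closedBall (0 : Plane) 1, EqUpToConst q (g q) (g' q))
    (γ : C(Circ, S)) :
    circleDegree (hu.toCircle.comp γ) = circleDegree (hu'.toCircle.comp γ) := by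
  obtain ⟨M, hM⟩ := exists_lift_of_lift_off_disk e he (hu.toCircle - hu'.toCircle)
    (fun y => u y - u' y) (fun x hx => (h x hx).continuousAt_sub hu hu')
    (fun x => by simp)
  refine circleDegree_eq_of_sub_eq (M.comp γ) fun θ => ?_
  rw [ContinuousMap.comp_apply, ContinuousMap.comp_apply, ContinuousMap.comp_apply, hM]
  simp

end Disk

/-! ### Orientation in the plane -/

section Plane

/-- The vector `v` turned to its right. -/
def turnRight (v : Plane) : Plane := !₂[v 1, -v 0]

@[simp] theorem turnRight_zero_apply (v : Plane) : turnRight v 0 = v 1 := by simp [turnRight]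

@[simp] theorem turnRight_one_apply (v : Plane) : turnRight v 1 = -v 0 := by simp [turnRight]

theorem continuous_turnRight : Continuous turnRight := by
  unfold turnRight
  fun_prop

theorem sq_add_sq_pos {v : Plane} (hv : v ≠ 0) : 0 < v 0 ^ 2 + v 1 ^ 2 := by
  by_contra h
  apply hv
  have h0 : v 0 = 0 := by nlinarith [sq_nonneg (v 0), sq_nonneg (v 1)]
  have h1 : v 1 = 0 := by nlinarith [sq_nonneg (v 0), sq_nonneg (v 1)]
  ext i
  fin_cases i <;> simpa

theorem decompose_turnRight (v w : Plane) :
    (v 0 ^ 2 + v 1 ^ 2) • w = (w 0 * v 0 + w 1 * v 1) • v + det₂ w v • turnRight v := by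
  ext i
  fin_cases i <;> simp [det₂] <;> ring

theorem det₂_turnRight (v : Plane) : det₂ (turnRight v) v = v 0 ^ 2 + v 1 ^ 2 := by
  simp [det₂]
  ring

/-- Applied to the derivative of a change of charts, whose determinant is positive for an oriented
atlas. -/
theorem det₂_map (T : Plane →L[ℝ] Plane) (v w : Plane) :
    det₂ (T v) (T w) = T.det * det₂ v w := by
  have hdet : T.det = T (EuclideanSpace.single 0 1) 0 * T (EuclideanSpace.single 1 1) 1 -
      T (EuclideanSpace.single 1 1) 0 * T (EuclideanSpace.single 0 1) 1 := by
    change LinearMap.det (T : Plane →ₗ[ℝ] Plane) = _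
    rw [← LinearMap.det_toMatrix (EuclideanSpace.basisFun (Fin 2) ℝ).toBasis, Matrix.det_fin_two]
    simp [LinearMap.toMatrix_apply]
  have hv : ∀ v : Plane, T v = v 0 • T (EuclideanSpace.single 0 1) +
      v 1 • T (EuclideanSpace.single 1 1) := fun v => by
    rw [← map_smul, ← map_smul, ← map_add]
    congr 1
    ext i
    fin_cases i <;> simp
  rw [hv v, hv w, hdet]
  simp [det₂]
  ring

/-- A linear form which vanishes on `v` and is positive to the right of `v` is a positive multiple
of the determinant with `v`. -/
theorem exists_pos_mul_det₂ {ℓ : Plane →L[ℝ] ℝ} {v : Plane} (hv : v ≠ 0) (h0 : ℓ v = 0)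
    (h1 : 0 < ℓ (turnRight v)) : ∃ c > 0, ∀ w, ℓ w = c * det₂ w v := by
  have hpos := sq_add_sq_pos hv
  refine ⟨ℓ (turnRight v) / (v 0 ^ 2 + v 1 ^ 2), div_pos h1 hpos, fun w => ?_⟩
  have := congrArg ℓ (decompose_turnRight v w)
  rw [map_add, map_smul, map_smul, map_smul, h0] at this
  simp only [smul_eq_mul] at this
  field_simp
  linarith

end Plane

/-! ### Closed curves read in charts -/

theorem nhds_circ (θ : Circ) : 𝓝 θ = map (fun h : ℝ => θ + (h : Circ)) (𝓝 0) := by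
  have h1 : map ((↑) : ℝ → Circ) (𝓝 0) = 𝓝 ((0 : ℝ) : Circ) :=
    (AddCircle.isLocalHomeomorph_coe (1 : ℝ)).map_nhds_eq 0
  have h2 := map_add_left_nhds θ ((0 : ℝ) : Circ)
  rw [← h1, map_map] at h2
  simpa [Function.comp_def] using h2.symm

theorem eventually_circ {θ : Circ} {p : Circ → Prop} :
    (∀ᶠ φ in 𝓝 θ, p φ) ↔ ∀ᶠ h : ℝ in 𝓝 0, p (θ + (h : Circ)) := by
  rw [nhds_circ θ, eventually_map]

theorem tendsto_circ_add (θ : Circ) : Tendsto (fun h : ℝ => θ + (h : Circ)) (𝓝 0) (𝓝 θ) := by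
  rw [nhds_circ θ]
  exact tendsto_map

section Charts

variable {S : Type*} [TopologicalSpace S]

/-- The closed curve `δ` near the parameter `θ`, read in the chart `e`. -/
def localCurve (e : OpenPartialHomeomorph S Plane) (δ : C(Circ, S)) (θ : Circ) (h : ℝ) : Plane :=
  e (δ (θ + (h : Circ)))

/-- The velocity of the closed curve `δ` at the parameter `θ`, read in the chart `e`. -/
def velocityIn (e : OpenPartialHomeomorph S Plane) (δ : C(Circ, S)) (θ : Circ) : Plane :=
  deriv (localCurve e δ θ) 0

theorem localCurve_zero (e : OpenPartialHomeomorph S Plane) (δ : C(Circ, S)) (θ : Circ) :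
    localCurve e δ θ 0 = e (δ θ) := by simp [localCurve]

theorem localCurve_add (e : OpenPartialHomeomorph S Plane) (δ : C(Circ, S)) (θ : Circ) (k : ℝ) :
    localCurve e δ (θ + (k : Circ)) = fun h => localCurve e δ θ (k + h) := by
  ext1 h
  simp [localCurve, add_assoc]

theorem velocityIn_add (e : OpenPartialHomeomorph S Plane) (δ : C(Circ, S)) (θ : Circ) (k : ℝ) :
    velocityIn e δ (θ + (k : Circ)) = deriv (localCurve e δ θ) k := by
  rw [velocityIn, localCurve_add, deriv_comp_const_add, add_zero]

theorem eventually_mem_source {e : OpenPartialHomeomorph S Plane} {δ : C(Circ, S)} {θ : Circ}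
    (h : δ θ ∈ e.source) : ∀ᶠ h : ℝ in 𝓝 0, δ (θ + (h : Circ)) ∈ e.source :=
  eventually_circ.1 (δ.continuous.continuousAt.eventually (e.open_source.mem_nhds h))

theorem mem_transition_source {e e' : OpenPartialHomeomorph S Plane} {x : S}
    (hx : x ∈ e.source) (hx' : x ∈ e'.source) : e x ∈ (e.symm.trans e').source := by
  simp [hx, hx']

variable [ChartedSpace Plane S]

theorem velocity_eq (δ : C(Circ, S)) (θ : Circ) :
    velocity δ θ = velocityIn (chartAt Plane (δ θ)) δ θ := rfl

variable [IsManifold (𝓡 2) ∞ S]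

theorem SmoothCurve.contDiffAt_localCurve {δ : C(Circ, S)} (hδ : SmoothCurve δ)
    {e : OpenPartialHomeomorph S Plane} (he : e ∈ atlas Plane S) {θ : Circ} (hθ : δ θ ∈ e.source) :
    ContDiffAt ℝ ∞ (localCurve e δ θ) 0 := by
  obtain ⟨t, rfl⟩ := QuotientAddGroup.mk_surjective θ
  have h1 : ContMDiffAt 𝓘(ℝ, ℝ) (𝓡 2) ∞ (fun s : ℝ => δ (s : Circ)) (t + 0) := hδ _
  have h2 : ContMDiffAt 𝓘(ℝ, ℝ) 𝓘(ℝ, ℝ) ∞ (fun h : ℝ => t + h) 0 :=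
    (contDiff_const.add contDiff_id).contMDiff _
  have h3 : ContMDiffAt (𝓡 2) (𝓡 2) ∞ e (δ ((t + 0 : ℝ) : Circ)) := by
    rw [add_zero]
    exact (contMDiffOn_of_mem_maximalAtlas (IsManifold.subset_maximalAtlas he)).contMDiffAt
      (e.open_source.mem_nhds hθ)
  exact (ContMDiffAt.comp (0 : ℝ) (ContMDiffAt.comp (t + 0) h3 h1) h2).contDiffAt

theorem SmoothCurve.hasDerivAt_localCurve {δ : C(Circ, S)} (hδ : SmoothCurve δ)
    {e : OpenPartialHomeomorph S Plane} (he : e ∈ atlas Plane S) {θ : Circ} (hθ : δ θ ∈ e.source) :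
    HasDerivAt (localCurve e δ θ) (velocityIn e δ θ) 0 :=
  ((hδ.contDiffAt_localCurve he hθ).differentiableAt (by simp)).hasDerivAt

theorem contDiffAt_transition {e e' : OpenPartialHomeomorph S Plane} (he : e ∈ atlas Plane S)
    (he' : e' ∈ atlas Plane S) {x : S} (hx : x ∈ e.source) (hx' : x ∈ e'.source) :
    ContDiffAt ℝ ∞ (e.symm.trans e') (e x) := by
  have h1 : ContMDiffAt (𝓡 2) (𝓡 2) ∞ e.symm (e x) :=
    (contMDiffOn_symm_of_mem_maximalAtlas (IsManifold.subset_maximalAtlas he)).contMDiffAt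
      (e.open_target.mem_nhds (e.map_source hx))
  have h2 : ContMDiffAt (𝓡 2) (𝓡 2) ∞ e' (e.symm (e x)) := by
    rw [e.left_inv hx]
    exact (contMDiffOn_of_mem_maximalAtlas (IsManifold.subset_maximalAtlas he')).contMDiffAt
      (e'.open_source.mem_nhds hx')
  exact (ContMDiffAt.comp (e x) h2 h1).contDiffAt

theorem SmoothCurve.velocityIn_eq_transition {δ : C(Circ, S)} (hδ : SmoothCurve δ)
    {e e' : OpenPartialHomeomorph S Plane} (he : e ∈ atlas Plane S)
    (he' : e' ∈ atlas Plane S) {θ : Circ} (hθ : δ θ ∈ e.source) (hθ' : δ θ ∈ e'.source) :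
    velocityIn e' δ θ = fderiv ℝ (e.symm.trans e') (e (δ θ)) (velocityIn e δ θ) := by
  have h1 := hδ.hasDerivAt_localCurve he hθ
  have h2 : HasFDerivAt (e.symm.trans e') (fderiv ℝ (e.symm.trans e') (e (δ θ)))
      (localCurve e δ θ 0) := by
    rw [localCurve_zero]
    exact ((contDiffAt_transition he he' hθ hθ').differentiableAt (by simp)).hasFDerivAt
  have h3 := h2.comp_hasDerivAt 0 h1
  refine ((h3.congr_of_eventuallyEq ?_).deriv)
  filter_upwards [eventually_mem_source hθ] with h hh
  simp [localCurve, e.left_inv hh]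

theorem SmoothCurve.velocityIn_ne_zero {δ : C(Circ, S)} (hδ : SmoothCurve δ)
    {e e' : OpenPartialHomeomorph S Plane} (he : e ∈ atlas Plane S)
    (he' : e' ∈ atlas Plane S) {θ : Circ} (hθ : δ θ ∈ e.source) (hθ' : δ θ ∈ e'.source)
    (h : velocityIn e δ θ ≠ 0) : velocityIn e' δ θ ≠ 0 := by
  intro h'
  apply h
  rw [hδ.velocityIn_eq_transition he' he hθ' hθ, h', map_zero]

end Charts

/-! ### Local defining functions of a strand -/

section Sides

variable {S : Type*} [TopologicalSpace S] [ChartedSpace Plane S]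

/-- In the chart `e`, the function `s` vanishes along the curve `δ` near the parameter `θ` and is a
defining function of the curve there, positive on its right. -/
structure IsSide (e : OpenPartialHomeomorph S Plane) (δ : C(Circ, S)) (θ : Circ) (s : S → ℝ) :
    Prop where
  mem_atlas : e ∈ atlas Plane S
  mem_source : δ θ ∈ e.source
  contDiffAt : ContDiffAt ℝ 1 (fun z => s (e.symm z)) (e (δ θ))
  eq_zero : ∀ᶠ φ in 𝓝 θ, s (δ φ) = 0
  fderiv_eq : ∃ c > 0, ∀ w, fderiv ℝ (fun z => s (e.symm z)) (e (δ θ)) w =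
    c * det₂ w (velocityIn e δ θ)

namespace IsSide

variable {e e' : OpenPartialHomeomorph S Plane} {δ : C(Circ, S)} {θ : Circ} {s : S → ℝ}

theorem hasFDerivAt (h : IsSide e δ θ s) : HasFDerivAt (fun z => s (e.symm z))
    (fderiv ℝ (fun z => s (e.symm z)) (e (δ θ))) (e (δ θ)) :=
  (h.contDiffAt.differentiableAt one_ne_zero).hasFDerivAt

theorem continuousAt (h : IsSide e δ θ s) : ∀ᶠ y in 𝓝 (δ θ), ContinuousAt s y := by
  have h1 : ∀ᶠ z in 𝓝 (e (δ θ)), ContDiffAt ℝ 1 (fun z => s (e.symm z)) z :=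
    h.contDiffAt.eventually (by simp)
  filter_upwards [(e.continuousAt h.mem_source).eventually h1,
    e.open_source.mem_nhds h.mem_source] with y hy hys
  refine (ContinuousAt.comp (f := e) hy.continuousAt (e.continuousAt hys)).congr ?_
  filter_upwards [e.open_source.mem_nhds hys] with x hx
  simp [e.left_inv hx]

variable [IsManifold (𝓡 2) ∞ S]

/-- The orientation of the surface enters here: the positive Jacobian keeps the factor in front of
the determinant positive, so "right of the strand" does not depend on the chart. -/
theorem change_chart (h : IsSide e δ θ s) (hS : IsOrientedAtlas S) (hδ : SmoothCurve δ)
    (he' : e' ∈ atlas Plane S) (hθ' : δ θ ∈ e'.source) : IsSide e' δ θ s := by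
  have hT : ContDiffAt ℝ ∞ (e'.symm.trans e) (e' (δ θ)) :=
    contDiffAt_transition he' h.mem_atlas hθ' h.mem_source
  have hTz : (e'.symm.trans e) (e' (δ θ)) = e (δ θ) := by simp [e'.left_inv hθ']
  have heq : (fun z => s (e'.symm z)) =ᶠ[𝓝 (e' (δ θ))]
      (fun z => s (e.symm z)) ∘ (e'.symm.trans e) := by
    filter_upwards [(e'.symm.trans e).open_source.mem_nhds (mem_transition_source hθ' h.mem_source)]
      with z hz
    rw [OpenPartialHomeomorph.trans_source] at hz
    have : e'.symm z ∈ e.source := hz.2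
    simp [e.left_inv this]
  refine ⟨he', hθ', ?_, h.eq_zero, ?_⟩
  · refine ContDiffAt.congr_of_eventuallyEq ?_ heq
    refine ContDiffAt.comp _ ?_ (hT.of_le (by simp))
    rw [hTz]
    exact h.contDiffAt
  · obtain ⟨c, hc, hw⟩ := h.fderiv_eq
    have hdet := hS e' he' e h.mem_atlas _ (mem_transition_source hθ' h.mem_source)
    refine ⟨c * (fderiv ℝ (e'.symm.trans e) (e' (δ θ))).det, mul_pos hc hdet, fun w => ?_⟩
    have h1 := h.hasFDerivAt
    rw [← hTz] at h1
    have h2 := (h1.comp _ (hT.differentiableAt (by simp)).hasFDerivAt).congr_of_eventuallyEq heq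
    rw [h2.fderiv, ContinuousLinearMap.comp_apply, hTz, hw,
      hδ.velocityIn_eq_transition he' h.mem_atlas hθ' h.mem_source, det₂_map]
    ring

theorem hasDerivAt_comp (h : IsSide e δ θ s) {γ : C(Circ, S)} (hγ : SmoothCurve γ) {φ : Circ}
    (hφ : γ φ = δ θ) : HasDerivAt (fun k : ℝ => s (γ (φ + (k : Circ))))
      (fderiv ℝ (fun z => s (e.symm z)) (e (δ θ)) (velocityIn e γ φ)) 0 := by
  have hsrc : γ φ ∈ e.source := hφ ▸ h.mem_source
  have h1 := hγ.hasDerivAt_localCurve h.mem_atlas hsrc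
  have h2 := h.hasFDerivAt
  rw [← hφ, ← localCurve_zero] at h2
  have h3 := h2.comp_hasDerivAt 0 h1
  rw [localCurve_zero, hφ] at h3
  refine h3.congr_of_eventuallyEq ?_
  filter_upwards [eventually_mem_source hsrc] with k hk
  simp [localCurve, e.left_inv hk]

/-- At nearby parameters the derivative of `s` still kills the tangent, because `s` vanishes along
the curve. It is still positive on the right turn of the tangent, by continuity. By
`exists_pos_mul_det₂` these two facts determine it up to a positive factor. -/
theorem eventually_isSide (h : IsSide e δ θ s) (hδ : SmoothCurve δ)
    (hv : velocityIn e δ θ ≠ 0) : ∀ᶠ φ in 𝓝 θ, IsSide e δ φ s := by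
  have hc := hδ.contDiffAt_localCurve h.mem_atlas h.mem_source
  have hcont : ContinuousAt (localCurve e δ θ) 0 := hc.continuousAt
  have hcont' : ContinuousAt (deriv (localCurve e δ θ)) 0 := by
    have := (hc.continuousAt_fderiv (by simp)).clm_apply (continuousAt_const (y := (1 : ℝ)))
    simpa using this
  have hs1 : ∀ᶠ z in 𝓝 (localCurve e δ θ 0), ContDiffAt ℝ 1 (fun z => s (e.symm z)) z := by
    rw [localCurve_zero]
    exact h.contDiffAt.eventually (by simp)
  have hs2 : ContinuousAt (fderiv ℝ (fun z => s (e.symm z))) (localCurve e δ θ 0) := by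
    rw [localCurve_zero]
    exact h.contDiffAt.continuousAt_fderiv one_ne_zero
  have hv' : deriv (localCurve e δ θ) 0 ≠ 0 := hv
  have hright : ∀ᶠ k in 𝓝 (0 : ℝ), 0 < fderiv ℝ (fun z => s (e.symm z)) (localCurve e δ θ k)
      (turnRight (deriv (localCurve e δ θ) k)) := by
    have h1 : ContinuousAt (fun k => fderiv ℝ (fun z => s (e.symm z)) (localCurve e δ θ k)
      (turnRight (deriv (localCurve e δ θ) k))) 0 :=
      (ContinuousAt.comp (f := localCurve e δ θ) hs2 hcont).clm_apply
        (ContinuousAt.comp (g := turnRight) continuous_turnRight.continuousAt hcont')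
    refine h1.eventually_const_lt ?_
    obtain ⟨c, hc, hw⟩ := h.fderiv_eq
    beta_reduce
    rw [localCurve_zero, hw]
    change 0 < c * det₂ (turnRight (velocityIn e δ θ)) _
    rw [det₂_turnRight]
    exact mul_pos hc (sq_add_sq_pos hv)
  have hzero := eventually_circ.1 h.eq_zero.eventually_nhds
  rw [eventually_circ]
  filter_upwards [hcont.eventually hs1, hright, hcont'.eventually_ne hv', hzero,
    eventually_mem_source h.mem_source] with k h1 h2 h3 h4 h5
  have hck : localCurve e δ θ k = e (δ (θ + (k : Circ))) := rfl
  refine ⟨h.mem_atlas, h5, h1, h4, ?_⟩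
  rw [velocityIn_add]
  refine exists_pos_mul_det₂ h3 ?_ h2
  have hd := hδ.hasDerivAt_localCurve h.mem_atlas h5
  have h6 : HasFDerivAt (fun z => s (e.symm z)) (fderiv ℝ (fun z => s (e.symm z))
    (e (δ (θ + (k : Circ))))) (localCurve e δ (θ + (k : Circ)) 0) := by
    rw [localCurve_zero]
    exact (h1.differentiableAt one_ne_zero).hasFDerivAt
  have h7 := h6.comp_hasDerivAt 0 hd
  rw [velocityIn_add] at h7
  refine h7.unique ((hasDerivAt_const (0 : ℝ) (0 : ℝ)).congr_of_eventuallyEq ?_)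
  filter_upwards [eventually_mem_source h5, eventually_circ.1 h4] with l hl hl'
  simp [localCurve, e.left_inv hl, hl']

end IsSide

end Sides

/-! ### Straightening a strand -/

section StrandChart

variable {S : Type*} [TopologicalSpace S]

/-- The linear coordinates of the plane with respect to `v` and its right turn. -/
theorem exists_frame {v : Plane} (hv : v ≠ 0) :
    ∃ A : (ℝ × ℝ) ≃L[ℝ] Plane, ∀ p, A p = p.1 • v + p.2 • turnRight v := by
  set f : (ℝ × ℝ) →ₗ[ℝ] Plane :=
    (LinearMap.toSpanSingleton ℝ Plane v).coprod (LinearMap.toSpanSingleton ℝ Plane (turnRight v))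
    with hf
  have hinj : Function.Injective f := by
    rw [injective_iff_map_eq_zero]
    rintro ⟨a, b⟩ h
    have h0 : a * v 0 + b * v 1 = 0 := by simpa [hf] using congrArg (fun w : Plane => w 0) h
    have h1 : a * v 1 + b * -v 0 = 0 := by simpa [hf] using congrArg (fun w : Plane => w 1) h
    have hpos := sq_add_sq_pos hv
    have ha : a * (v 0 ^ 2 + v 1 ^ 2) = 0 := by linear_combination v 0 * h0 + v 1 * h1
    have hb : b * (v 0 ^ 2 + v 1 ^ 2) = 0 := by linear_combination v 1 * h0 - v 0 * h1
    have ha' := (mul_eq_zero.1 ha).resolve_right hpos.ne'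
    have hb' := (mul_eq_zero.1 hb).resolve_right hpos.ne'
    rw [ha', hb', Prod.mk_zero_zero]
  exact ⟨(f.linearEquivOfInjective hinj (by simp)).toContinuousLinearEquiv, fun p => by
    simp [hf]⟩

/-- `Φ` straightens the curve `δ` near the parameter `θ` in the chart `e`: the curve becomes the
first axis. -/
structure IsStrandChart (e : OpenPartialHomeomorph S Plane) (δ : C(Circ, S)) (θ : Circ)
    (Φ : OpenPartialHomeomorph (ℝ × ℝ) Plane) : Prop where
  mem_source : 0 ∈ Φ.source
  apply_eq : ∀ p, Φ p = localCurve e δ θ p.1 + p.2 • turnRight (velocityIn e δ θ)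
  contDiffAt : ContDiffAt ℝ ∞ Φ.symm (e (δ θ))
  fderiv_eq : ∃ c > 0, ∀ w, fderiv ℝ (fun z => (Φ.symm z).2) (e (δ θ)) w =
    c * det₂ w (velocityIn e δ θ)

namespace IsStrandChart

variable {e : OpenPartialHomeomorph S Plane} {δ : C(Circ, S)} {θ : Circ}
  {Φ : OpenPartialHomeomorph (ℝ × ℝ) Plane}

theorem apply_zero (h : IsStrandChart e δ θ Φ) : Φ 0 = e (δ θ) := by
  simp [h.apply_eq, localCurve_zero]

theorem mem_target (h : IsStrandChart e δ θ Φ) : e (δ θ) ∈ Φ.target :=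
  h.apply_zero ▸ Φ.map_source h.mem_source

theorem symm_apply (h : IsStrandChart e δ θ Φ) : Φ.symm (e (δ θ)) = 0 := by
  rw [← h.apply_zero, Φ.left_inv h.mem_source]

theorem apply_axis (h : IsStrandChart e δ θ Φ) (a : ℝ) :
    Φ (a, 0) = e (δ (θ + (a : Circ))) := by
  simp [h.apply_eq, localCurve]

theorem eventually_axis (h : IsStrandChart e δ θ Φ) : ∀ᶠ a : ℝ in 𝓝 0, (a, (0 : ℝ)) ∈ Φ.source :=
  (Continuous.continuousAt (f := fun a : ℝ => (a, (0 : ℝ))) (by fun_prop)).eventually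
    (Φ.open_source.mem_nhds h.mem_source)

theorem tendsto_symm (h : IsStrandChart e δ θ Φ) (hθ : δ θ ∈ e.source) :
    Tendsto (fun y => Φ.symm (e y)) (𝓝 (δ θ)) (𝓝 0) := by
  have := ContinuousAt.comp (f := e) (Φ.symm.continuousAt h.mem_target) (e.continuousAt hθ)
  rw [ContinuousAt, Function.comp_apply, h.symm_apply] at this
  exact this

theorem eventually_right_inv (h : IsStrandChart e δ θ Φ) (hθ : δ θ ∈ e.source) :
    ∀ᶠ y in 𝓝 (δ θ), y ∈ e.source ∧ Φ (Φ.symm (e y)) = e y := by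
  filter_upwards [e.open_source.mem_nhds hθ,
    (e.continuousAt hθ).eventually (Φ.open_target.mem_nhds h.mem_target)] with y h1 h2
  exact ⟨h1, Φ.right_inv h2⟩

theorem exists_injOn (h : IsStrandChart e δ θ Φ) : ∃ N ∈ 𝓝 θ, InjOn δ N := by
  refine ⟨(fun a : ℝ => θ + (a : Circ)) '' {a | (a, (0 : ℝ)) ∈ Φ.source}, ?_, ?_⟩
  · rw [nhds_circ]
    exact image_mem_map h.eventually_axis
  · rintro _ ⟨a, ha, rfl⟩ _ ⟨b, hb, rfl⟩ hab
    have : Φ (a, 0) = Φ (b, 0) := by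
      rw [h.apply_axis, h.apply_axis]
      exact congrArg e hab
    have := Φ.injOn ha hb this
    simp only [Prod.mk.injEq, and_true] at this
    simp [this]

variable [ChartedSpace Plane S]

theorem isSide (h : IsStrandChart e δ θ Φ) (he : e ∈ atlas Plane S) (hθ : δ θ ∈ e.source) :
    IsSide e δ θ fun y => (Φ.symm (e y)).2 := by
  have heq : (fun z => (Φ.symm (e (e.symm z))).2) =ᶠ[𝓝 (e (δ θ))] fun z => (Φ.symm z).2 := by
    filter_upwards [e.open_target.mem_nhds (e.map_source hθ)] with z hz
    rw [e.right_inv hz]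
  refine ⟨he, hθ, ?_, ?_, ?_⟩
  · exact ((h.contDiffAt.snd).of_le (by simp)).congr_of_eventuallyEq heq
  · rw [eventually_circ]
    filter_upwards [h.eventually_axis] with a ha
    rw [← h.apply_axis, Φ.left_inv ha]
  · rw [heq.fderiv_eq]
    exact h.fderiv_eq

/-- A side function has the sign of the second coordinate of a strand chart. -/
theorem eventually_sign_eq (h : IsStrandChart e δ θ Φ) (hv : velocityIn e δ θ ≠ 0) {s : S → ℝ}
    (hs : IsSide e δ θ s) :
    ∀ᶠ p in 𝓝 (0 : ℝ × ℝ), SignType.sign (s (e.symm (Φ p))) = SignType.sign p.2 := by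
  set v := velocityIn e δ θ with hvdef
  set f : ℝ × ℝ → ℝ := fun p => s (e.symm (Φ p)) with hf
  have hΦ : ContinuousAt Φ 0 := Φ.continuousAt h.mem_source
  have h1 : ∀ᶠ p in 𝓝 (0 : ℝ × ℝ), DifferentiableAt ℝ (fun z => s (e.symm z)) (Φ p) ∧
      0 < fderiv ℝ (fun z => s (e.symm z)) (Φ p) (turnRight v) := by
    rw [ContinuousAt, h.apply_zero] at hΦ
    have h4 : ∀ᶠ z in 𝓝 (e (δ θ)), DifferentiableAt ℝ (fun z => s (e.symm z)) z :=
      (hs.contDiffAt.eventually (by simp)).mono fun z hz => hz.differentiableAt one_ne_zero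
    have h5 : ∀ᶠ z in 𝓝 (e (δ θ)), 0 < fderiv ℝ (fun z => s (e.symm z)) z (turnRight v) := by
      refine ((hs.contDiffAt.continuousAt_fderiv one_ne_zero).clm_apply
        (continuousAt_const (y := turnRight v))).eventually_const_lt ?_
      obtain ⟨c, hc, hw⟩ := hs.fderiv_eq
      beta_reduce
      rw [hw, ← hvdef, det₂_turnRight]
      exact mul_pos hc (sq_add_sq_pos hv)
    exact hΦ.eventually (h4.and h5)
  have h2 : ∀ᶠ p in 𝓝 (0 : ℝ × ℝ), f (p.1, 0) = 0 := by
    have h3 : ∀ᶠ a : ℝ in 𝓝 0, f (a, 0) = 0 := by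
      filter_upwards [eventually_circ.1 hs.eq_zero, eventually_mem_source hs.mem_source]
        with a ha ha'
      simp only [hf]
      rw [h.apply_axis, e.left_inv ha', ha]
    exact (continuous_fst.tendsto (0 : ℝ × ℝ)).eventually h3
  obtain ⟨r, hr, hball⟩ := Metric.eventually_nhds_iff.1 (h1.and h2)
  refine Metric.eventually_nhds_iff.2 ⟨r, hr, ?_⟩
  rintro ⟨a, b⟩ hp
  have hab : |a| < r ∧ |b| < r := by simpa [Prod.dist_eq] using hp
  have hmem : ∀ b', |b'| < r → dist (a, b') (0 : ℝ × ℝ) < r := fun b' hb' => by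
    simpa [Prod.dist_eq] using ⟨hab.1, hb'⟩
  have hder : ∀ b', |b'| < r → HasDerivAt (fun b' => f (a, b'))
      (fderiv ℝ (fun z => s (e.symm z)) (Φ (a, b')) (turnRight v)) b' := fun b' hb' => by
    have h4 : HasDerivAt (fun b' => Φ (a, b')) (turnRight v) b' := by
      simp only [h.apply_eq]
      simpa using ((hasDerivAt_id b').smul_const (turnRight v)).const_add (localCurve e δ θ a)
    exact ((hball (hmem b' hb')).1.1.hasFDerivAt).comp_hasDerivAt b' h4
  -- On each short segment transverse to the strand, `s` increases strictly, and it vanishes where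
  -- the segment meets the axis.
  have hmono : StrictMonoOn (fun b' => f (a, b')) (Ioo (-r) r) := by
    refine strictMonoOn_of_deriv_pos (convex_Ioo _ _) ?_ ?_
    · exact fun b' hb' => (hder b' (abs_lt.2 hb')).continuousAt.continuousWithinAt
    · intro b' hb'
      rw [interior_Ioo] at hb'
      rw [(hder b' (abs_lt.2 hb')).deriv]
      exact (hball (hmem b' (abs_lt.2 hb'))).1.2
  have hzero : f (a, 0) = 0 := (hball hp).2
  have h0mem : (0 : ℝ) ∈ Ioo (-r) r := ⟨by linarith, hr⟩
  have hbmem : b ∈ Ioo (-r) r := abs_lt.1 hab.2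
  change SignType.sign (f (a, b)) = SignType.sign b
  rcases lt_trichotomy b 0 with hb | hb | hb
  · have h5 : f (a, b) < f (a, 0) := hmono hbmem h0mem hb
    rw [hzero] at h5
    rw [sign_neg h5, sign_neg hb]
  · rw [hb, hzero]
  · have h5 : f (a, 0) < f (a, b) := hmono h0mem hbmem hb
    rw [hzero] at h5
    rw [sign_pos h5, sign_pos hb]

theorem eventually_sign_eq' (h : IsStrandChart e δ θ Φ) (hv : velocityIn e δ θ ≠ 0) {s : S → ℝ}
    (hs : IsSide e δ θ s) :
    ∀ᶠ y in 𝓝 (δ θ), SignType.sign (s y) = SignType.sign (Φ.symm (e y)).2 := by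
  filter_upwards [(h.tendsto_symm hs.mem_source).eventually (h.eventually_sign_eq hv hs),
    h.eventually_right_inv hs.mem_source] with y h1 h2
  rwa [h2.2, e.left_inv h2.1] at h1

end IsStrandChart

/-- The inverse function theorem applies to `(a, b) ↦ curve a + b • turnRight v`, whose derivative
at the origin is the frame formed by `v` and its right turn. -/
theorem SmoothCurve.exists_isStrandChart [ChartedSpace Plane S] [IsManifold (𝓡 2) ∞ S] {δ : C(Circ, S)}
    (hδ : SmoothCurve δ) {e : OpenPartialHomeomorph S Plane} (he : e ∈ atlas Plane S) {θ : Circ}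
    (hθ : δ θ ∈ e.source) (hv : velocityIn e δ θ ≠ 0) : ∃ Φ, IsStrandChart e δ θ Φ := by
  set v := velocityIn e δ θ with hvdef
  obtain ⟨A, hA⟩ := exists_frame hv
  set Ψ : ℝ × ℝ → Plane := fun p => localCurve e δ θ p.1 + p.2 • turnRight v with hΨ
  have hc := hδ.contDiffAt_localCurve he hθ
  have hsmooth : ContDiffAt ℝ ∞ Ψ 0 := by
    refine ContDiffAt.add ?_ ?_
    · exact ContDiffAt.comp (g := localCurve e δ θ) (0 : ℝ × ℝ) hc contDiffAt_fst
    · exact contDiffAt_snd.smul contDiffAt_const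
  have hder : HasFDerivAt Ψ (A : (ℝ × ℝ) →L[ℝ] Plane) 0 := by
    have h1 : HasFDerivAt (fun p : ℝ × ℝ => localCurve e δ θ p.1)
        ((ContinuousLinearMap.toSpanSingleton ℝ v).comp (ContinuousLinearMap.fst ℝ ℝ ℝ)) 0 :=
      HasFDerivAt.comp (g := localCurve e δ θ) (0 : ℝ × ℝ)
        (hδ.hasDerivAt_localCurve he hθ).hasFDerivAt hasFDerivAt_fst
    have h2 : HasFDerivAt (fun p : ℝ × ℝ => p.2 • turnRight v)
        ((ContinuousLinearMap.snd ℝ ℝ ℝ).smulRight (turnRight v)) 0 :=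
      (ContinuousLinearMap.snd ℝ ℝ ℝ).hasFDerivAt.smul_const (turnRight v)
    refine (h1.add h2).congr_fderiv ?_
    refine ContinuousLinearMap.ext fun p => ?_
    simp [hA]
  set Φ := hsmooth.toOpenPartialHomeomorph Ψ hder (by simp) with hΦ
  have hcoe : ∀ p, Φ p = Ψ p := fun p => rfl
  have h0 : (0 : ℝ × ℝ) ∈ Φ.source := hsmooth.mem_toOpenPartialHomeomorph_source hder (by simp)
  have hΦ0 : Φ 0 = e (δ θ) := by simp [hcoe, hΨ, localCurve_zero]
  have htgt : e (δ θ) ∈ Φ.target := hΦ0 ▸ Φ.map_source h0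
  have hsymm : Φ.symm (e (δ θ)) = 0 := by rw [← hΦ0, Φ.left_inv h0]
  have hinv : HasFDerivAt Φ.symm (A.symm : Plane →L[ℝ] (ℝ × ℝ)) (e (δ θ)) :=
    Φ.hasFDerivAt_symm htgt (by rw [hsymm]; exact hder)
  refine ⟨Φ, h0, hcoe, ?_, ?_⟩
  · exact hΦ0 ▸ hsmooth.to_localInverse hder (by simp)
  · have h3 : HasFDerivAt (fun z => (Φ.symm z).2)
      ((ContinuousLinearMap.snd ℝ ℝ ℝ).comp (A.symm : Plane →L[ℝ] (ℝ × ℝ))) (e (δ θ)) :=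
      (ContinuousLinearMap.snd ℝ ℝ ℝ).hasFDerivAt.comp _ hinv
    rw [h3.fderiv]
    have e1 : A.symm v = (1, 0) := by rw [A.symm_apply_eq]; simp [hA]
    have e2 : A.symm (turnRight v) = (0, 1) := by rw [A.symm_apply_eq]; simp [hA]
    exact exists_pos_mul_det₂ (v := v) hv
      (show (A.symm v).2 = 0 by rw [e1]) (show 0 < (A.symm (turnRight v)).2 by rw [e2]; exact one_pos)

namespace IsSide

variable [ChartedSpace Plane S] [IsManifold (𝓡 2) ∞ S] {e : OpenPartialHomeomorph S Plane} {δ : C(Circ, S)} {θ : Circ}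
  {s s' : S → ℝ}

/-- Both signs are that of the second coordinate of a strand chart. Hence the germ of the right hand
side does not depend on the function chosen in `sheet`. -/
theorem eventually_sign_eq (h : IsSide e δ θ s) (h' : IsSide e δ θ s') (hδ : SmoothCurve δ)
    (hv : velocityIn e δ θ ≠ 0) :
    ∀ᶠ y in 𝓝 (δ θ), SignType.sign (s y) = SignType.sign (s' y) := by
  obtain ⟨Φ, hΦ⟩ := hδ.exists_isStrandChart h.mem_atlas h.mem_source hv
  filter_upwards [hΦ.eventually_sign_eq' hv h, hΦ.eventually_sign_eq' hv h'] with y h1 h2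
  rw [h1, h2]

/-- Near the point, the zero set of a defining function is no larger than the strand. -/
theorem eventually_exists_of_eq_zero (h : IsSide e δ θ s) (hδ : SmoothCurve δ)
    (hv : velocityIn e δ θ ≠ 0) {N : Set Circ} (hN : N ∈ 𝓝 θ) :
    ∀ᶠ y in 𝓝 (δ θ), s y = 0 → ∃ φ ∈ N, δ φ = y := by
  obtain ⟨Φ, hΦ⟩ := hδ.exists_isStrandChart h.mem_atlas h.mem_source hv
  have h1 : ∀ᶠ p in 𝓝 (0 : ℝ × ℝ), θ + ((p.1 : ℝ) : Circ) ∈ N ∧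
      δ (θ + ((p.1 : ℝ) : Circ)) ∈ e.source :=
    (continuous_fst.tendsto (0 : ℝ × ℝ)).eventually
      ((eventually_circ.1 hN).and (eventually_mem_source h.mem_source))
  filter_upwards [hΦ.eventually_sign_eq' hv h, hΦ.eventually_right_inv h.mem_source,
    (hΦ.tendsto_symm h.mem_source).eventually h1] with y h2 h3 h4 h5
  rw [h5, sign_zero, eq_comm, sign_eq_zero_iff] at h2
  refine ⟨_, h4.1, e.injOn h4.2 h3.1 ?_⟩
  have h6 : ((Φ.symm (e y)).1, (0 : ℝ)) = Φ.symm (e y) := Prod.ext rfl h2.symm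
  rw [← hΦ.apply_axis, h6, h3.2]

end IsSide

end StrandChart

/-! ### The right hand side of a strand -/

section Sheets

variable {S : Type*} [TopologicalSpace S] [ChartedSpace Plane S]

/-- A smooth closed curve with nowhere vanishing velocity. -/
structure IsImmersedLoop (δ : C(Circ, S)) : Prop where
  smooth : SmoothCurve δ
  velocity_ne_zero : ∀ θ, velocity δ θ ≠ 0

open Classical in
/-- The indicator function of the right hand side of the curve `δ` at the parameter `θ`. Only its
germ along the curve near this parameter is meaningful. -/
def sheet (δ : C(Circ, S)) (θ : Circ) (y : S) : ℤ :=
  if h : ∃ s, IsSide (chartAt Plane (δ θ)) δ θ s then if 0 < h.choose y then 1 else 0 else 0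

variable [IsManifold (𝓡 2) ∞ S] {δ : C(Circ, S)}

theorem IsImmersedLoop.velocityIn_ne_zero (hδ : IsImmersedLoop δ)
    {e : OpenPartialHomeomorph S Plane} (he : e ∈ atlas Plane S) {θ : Circ}
    (hθ : δ θ ∈ e.source) : velocityIn e δ θ ≠ 0 :=
  hδ.smooth.velocityIn_ne_zero (chart_mem_atlas Plane (δ θ)) he (mem_chart_source Plane (δ θ)) hθ
    (hδ.velocity_ne_zero θ)

theorem IsImmersedLoop.exists_isSide (hδ : IsImmersedLoop δ) (θ : Circ) :
    ∃ s, IsSide (chartAt Plane (δ θ)) δ θ s := by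
  obtain ⟨Φ, hΦ⟩ := hδ.smooth.exists_isStrandChart (chart_mem_atlas Plane (δ θ))
    (mem_chart_source Plane (δ θ)) (hδ.velocity_ne_zero θ)
  exact ⟨_, hΦ.isSide (chart_mem_atlas Plane (δ θ)) (mem_chart_source Plane (δ θ))⟩

theorem IsSide.sheet_eq {e : OpenPartialHomeomorph S Plane} {θ : Circ} {s : S → ℝ}
    (h : IsSide e δ θ s) (hS : IsOrientedAtlas S) (hδ : IsImmersedLoop δ) :
    ∀ᶠ y in 𝓝 (δ θ), sheet δ θ y = if 0 < s y then 1 else 0 := by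
  classical
  have hex := hδ.exists_isSide θ
  have h' := h.change_chart hS hδ.smooth (chart_mem_atlas Plane (δ θ))
    (mem_chart_source Plane (δ θ))
  filter_upwards [hex.choose_spec.eventually_sign_eq h' hδ.smooth (hδ.velocity_ne_zero θ)]
    with y hy
  have : 0 < hex.choose y ↔ 0 < s y := by rw [← sign_eq_one_iff, hy, sign_eq_one_iff]
  simp only [sheet, hex, dif_pos, this]

theorem IsImmersedLoop.exists_injOn (hδ : IsImmersedLoop δ) (θ : Circ) :
    ∃ N ∈ 𝓝 θ, InjOn δ N := by
  obtain ⟨Φ, hΦ⟩ := hδ.smooth.exists_isStrandChart (chart_mem_atlas Plane (δ θ))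
    (mem_chart_source Plane (δ θ)) (hδ.velocity_ne_zero θ)
  exact hΦ.exists_injOn

theorem IsImmersedLoop.finite_fiber [T2Space S] (hδ : IsImmersedLoop δ) (q : S) : {θ | δ θ = q}.Finite := by
  have := finite_of_isCompact_of_isolated (k := univ) (s := {θ | δ θ = q}) isCompact_univ
    fun θ _ => by
      obtain ⟨N, hN, hinj⟩ := hδ.exists_injOn θ
      by_cases hq : δ θ = q
      · rw [eventually_nhdsWithin_iff]
        filter_upwards [hN] with φ hφ hne h
        exact hne (hinj hφ (mem_of_mem_nhds hN) (h.trans hq.symm))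
      · exact eventually_nhdsWithin_of_eventually_nhds
          (δ.continuous.continuousAt.eventually_ne hq)
  simpa using this

/-- Near a parameter `θ` the sheet at `θ` represents the sheets at all other points of the strand,
and it is locally constant off the strand. -/
theorem IsImmersedLoop.exists_strand_nhds (hδ : IsImmersedLoop δ) (hS : IsOrientedAtlas S)
    (θ : Circ) : ∃ N₀ ∈ 𝓝 θ, ∀ N ∈ 𝓝 θ, N ⊆ N₀ → ∀ᶠ q in 𝓝 (δ θ),
      (∃ φ ∈ N, δ φ = q ∧ (∀ ψ ∈ N, δ ψ = q → ψ = φ) ∧ ∀ᶠ y in 𝓝 q, sheet δ θ y = sheet δ φ y) ∨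
      ((∀ φ ∈ N, δ φ ≠ q) ∧ ∃ c, ∀ᶠ y in 𝓝 q, sheet δ θ y = c) := by
  obtain ⟨s, hs⟩ := hδ.exists_isSide θ
  obtain ⟨N₁, hN₁, hinj⟩ := hδ.exists_injOn θ
  refine ⟨_, inter_mem hN₁ (hs.eventually_isSide hδ.smooth (hδ.velocity_ne_zero θ)),
    fun N hN hsub => ?_⟩
  filter_upwards [(hs.sheet_eq hS hδ).eventually_nhds, hs.continuousAt,
    hs.eventually_exists_of_eq_zero hδ.smooth (hδ.velocity_ne_zero θ) hN] with q h1 h2 h3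
  -- Zeros of `s` lie on the strand, where `s` remains a defining function. At the other points `s`
  -- keeps its sign nearby.
  by_cases hq : s q = 0
  · obtain ⟨φ, hφ, rfl⟩ := h3 hq
    refine Or.inl ⟨φ, hφ, rfl, fun ψ hψ h => hinj (hsub hψ).1 (hsub hφ).1 h, ?_⟩
    have h4 : IsSide (chartAt Plane (δ θ)) δ φ s := (hsub hφ).2
    filter_upwards [h1, h4.sheet_eq hS hδ] with y h5 h6
    rw [h5, h6]
  · refine Or.inr ⟨fun φ hφ h => ?_, ?_⟩
    · have h4 : IsSide (chartAt Plane (δ θ)) δ φ s := (hsub hφ).2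
      exact hq (h ▸ h4.eq_zero.self_of_nhds)
    · rcases lt_or_gt_of_ne hq with h | h
      · refine ⟨0, ?_⟩
        filter_upwards [h1, h2.eventually_lt_const h] with y h5 h6
        rw [h5, if_neg (by linarith)]
      · refine ⟨1, ?_⟩
        filter_upwards [h1, h2.eventually_const_lt h] with y h5 h6
        rw [h5, if_pos h6]

theorem eventually_pos_of_deriv_pos {f : ℝ → ℝ} {d : ℝ} (hf : HasDerivAt f d 0) (h0 : f 0 = 0)
    (hd : 0 < d) : ∀ᶠ h in 𝓝[>] (0 : ℝ), 0 < f h ∧ f (-h) < 0 := by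
  have h1 := (hasDerivAt_iff_tendsto_slope_zero.1 hf).eventually (lt_mem_nhds hd)
  simp only [zero_add, h0, sub_zero, smul_eq_mul] at h1
  rw [eventually_nhdsWithin_iff, Metric.eventually_nhds_iff] at h1
  obtain ⟨ε, hε, h⟩ := h1
  refine eventually_nhdsGT_zero_iff.2 ⟨ε, hε, fun k hk0 hk1 => ⟨?_, ?_⟩⟩
  · have := h (y := k) (by simpa [abs_of_pos hk0] using hk1) hk0.ne'
    exact (pos_iff_pos_of_mul_pos this).1 (inv_pos.2 hk0)
  · have := h (y := -k) (by simpa [abs_of_pos hk0] using hk1) (by simpa using hk0.ne')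
    rw [inv_neg] at this
    have h2 := inv_pos.2 hk0
    nlinarith

/-- A curve transverse to the strand of `δ` at `θ` passes from one side of it to the other. -/
theorem IsImmersedLoop.sheet_of_transverse (hδ : IsImmersedLoop δ) (hS : IsOrientedAtlas S)
    {γ : C(Circ, S)} (hγ : SmoothCurve γ) {φ θ : Circ} (hφ : γ φ = δ θ)
    (hd : det₂ (velocity γ φ) (velocity δ θ) ≠ 0) :
    (∀ᶠ h : ℝ in 𝓝[>] 0,
      (∀ᶠ y in 𝓝 (γ (φ + (h : Circ))),
        sheet δ θ y = if 0 < det₂ (velocity γ φ) (velocity δ θ) then 1 else 0) ∧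
      (∀ᶠ y in 𝓝 (γ (φ - (h : Circ))),
        sheet δ θ y = if 0 < det₂ (velocity γ φ) (velocity δ θ) then 0 else 1)) ∧
    ∃ N ∈ 𝓝 θ, ∀ᶠ h : ℝ in 𝓝[>] 0, ∀ ψ ∈ N, δ ψ ≠ γ (φ + (h : Circ)) ∧
      δ ψ ≠ γ (φ - (h : Circ)) := by
  obtain ⟨s, hs⟩ := hδ.exists_isSide θ
  have hder := hs.hasDerivAt_comp hγ hφ
  obtain ⟨c, hc, hw⟩ := hs.fderiv_eq
  rw [hw, ← velocity_eq, ← hφ, ← velocity_eq] at hder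
  have hs0 : s (γ (φ + ((0 : ℝ) : Circ))) = 0 := by
    rw [AddCircle.coe_zero, add_zero, hφ]
    exact hs.eq_zero.self_of_nhds
  have htend : Tendsto (fun h : ℝ => γ (φ + (h : Circ))) (𝓝 0) (𝓝 (δ θ)) := by
    rw [← hφ]
    exact γ.continuous.continuousAt.tendsto.comp (tendsto_circ_add φ)
  have hloc : ∀ᶠ h : ℝ in 𝓝 0, (∀ᶠ y in 𝓝 (γ (φ + (h : Circ))), sheet δ θ y =
      if 0 < s y then 1 else 0) ∧ ContinuousAt s (γ (φ + (h : Circ))) :=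
    htend.eventually ((hs.sheet_eq hS hδ).eventually_nhds.and hs.continuousAt)
  have hloc1 := eventually_nhdsWithin_of_eventually_nhds (s := Ioi (0 : ℝ)) hloc
  have hneg : Tendsto (fun h : ℝ => -h) (𝓝 0) (𝓝 0) := by
    simpa using (continuous_neg (G := ℝ)).tendsto 0
  have hloc2 := eventually_nhdsWithin_of_eventually_nhds (s := Ioi (0 : ℝ)) (hneg.eventually hloc)
  rcases lt_or_gt_of_ne hd with hneg' | hpos
  -- A negative intersection is reduced to a positive derivative by passing to `-s`.
  · have hsign : ∀ᶠ h : ℝ in 𝓝[>] 0, 0 < -s (γ (φ + (h : Circ))) ∧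
        -s (γ (φ + ((-h : ℝ) : Circ))) < 0 :=
      eventually_pos_of_deriv_pos hder.neg (by simpa using hs0) (by nlinarith)
    -- The neighborhood is the set of parameters at which `s` vanishes along `δ`. The curve `γ`
    -- leaves the zero set of `s` and so avoids this strand.
    refine ⟨?_, _, hs.eq_zero, ?_⟩
    · filter_upwards [hloc1, hloc2, hsign] with h h1 h2 h3
      simp only [AddCircle.coe_neg, ← sub_eq_add_neg] at h1 h2 h3
      rw [if_neg (by linarith), if_neg (by linarith)]
      constructor
      · filter_upwards [h1.1, h1.2.eventually_lt_const (neg_pos.1 h3.1)] with y h5 h6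
        rw [h5, if_neg (by linarith)]
      · filter_upwards [h2.1, h2.2.eventually_const_lt (neg_neg_iff_pos.1 h3.2)] with y h5 h6
        rw [h5, if_pos h6]
    · filter_upwards [hsign] with h h3 ψ hψ
      simp only [AddCircle.coe_neg, ← sub_eq_add_neg] at h3
      have hψ : s (δ ψ) = 0 := hψ
      constructor
      · intro h4
        rw [h4] at hψ
        linarith [h3.1]
      · intro h4
        rw [h4] at hψ
        linarith [h3.2]
  · have hsign := eventually_pos_of_deriv_pos hder hs0 (mul_pos hc hpos)
    refine ⟨?_, _, hs.eq_zero, ?_⟩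
    · filter_upwards [hloc1, hloc2, hsign] with h h1 h2 h3
      simp only [AddCircle.coe_neg, ← sub_eq_add_neg] at h1 h2 h3
      rw [if_pos hpos, if_pos hpos]
      constructor
      · filter_upwards [h1.1, h1.2.eventually_const_lt h3.1] with y h5 h6
        rw [h5, if_pos h6]
      · filter_upwards [h2.1, h2.2.eventually_lt_const h3.2] with y h5 h6
        rw [h5, if_neg (by linarith)]
    · filter_upwards [hsign] with h h3 ψ hψ
      simp only [AddCircle.coe_neg, ← sub_eq_add_neg] at h3
      have hψ : s (δ ψ) = 0 := hψ
      constructor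
      · intro h4
        rw [h4] at hψ
        linarith [h3.1]
      · intro h4
        rw [h4] at hψ
        linarith [h3.2]

end Sheets

/-! ### Coherence of the germs of a loop and of a loop with a corner -/

section EqUpToConst

variable {S : Type*} [TopologicalSpace S] {x : S}

theorem EqUpToConst.of_eventuallyEq {g g' : S → ℤ} (h : ∀ᶠ y in 𝓝 x, g y = g' y) :
    EqUpToConst x g g' := ⟨0, by simpa using h⟩

theorem EqUpToConst.sum {ι : Type*} (I : Finset ι) {g g' : ι → S → ℤ}
    (h : ∀ i ∈ I, EqUpToConst x (g i) (g' i)) :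
    EqUpToConst x (fun y => ∑ i ∈ I, g i y) (fun y => ∑ i ∈ I, g' i y) := by
  choose! c hc using h
  refine ⟨∑ i ∈ I, c i, ?_⟩
  filter_upwards [(eventually_all_finset I).2 hc] with y hy
  rw [← Finset.sum_add_distrib]
  exact Finset.sum_congr rfl fun i hi => hy i hi

end EqUpToConst

section Germs

variable {S : Type*} [TopologicalSpace S]

/-- The parameters of the points near `x` are near the parameters of `x`. -/
theorem eventually_fiber_subset [T2Space S] (δ : C(Circ, S)) (x : S) {V : Set Circ}
    (hV : ∀ θ, δ θ = x → V ∈ 𝓝 θ) : ∀ᶠ q in 𝓝 x, ∀ φ, δ φ = q → φ ∈ V := by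
  have hcl : IsClosed (δ '' (interior V)ᶜ) :=
    (isOpen_interior.isClosed_compl.isCompact.image δ.continuous).isClosed
  have hx : x ∉ δ '' (interior V)ᶜ := by
    rintro ⟨θ, hθ, rfl⟩
    exact hθ (mem_interior_iff_mem_nhds.2 (hV θ rfl))
  filter_upwards [hcl.isOpen_compl.mem_nhds hx] with q hq φ hφ
  by_contra h
  exact hq ⟨φ, fun h' => h (interior_subset h'), hφ⟩

variable [ChartedSpace Plane S]

/-- The germ at `q` of the sum of the sheets of the strands of `δ` through `q` with parameters
in `A`. -/
def sheetSum (δ : C(Circ, S)) (A : Set Circ) (q y : S) : ℤ :=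
  ∑ᶠ θ ∈ {θ | θ ∈ A ∧ δ θ = q}, sheet δ θ y

open Classical in
/-- The germs of the sheets of the part of `δ` with parameters in `A`, which starts at `u` and ends
at `o`, where `δ u = δ o`; at this corner, the germ is the indicator function of the sector between
the two branches which lies on the right. -/
def cornerSum (δ : C(Circ, S)) (A : Set Circ) (u o : Circ) (q y : S) : ℤ :=
  if q = δ u then
    if 0 < det₂ (velocity δ u) (velocity δ o) then sheet δ u y * sheet δ o y
    else sheet δ u y + sheet δ o y - sheet δ u y * sheet δ o y
  else sheetSum δ A q y

theorem cornerSum_of_ne {δ : C(Circ, S)} {A : Set Circ} {u o : Circ} {q : S} (h : q ≠ δ u) :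
    cornerSum δ A u o q = sheetSum δ A q := by
  ext y
  simp [cornerSum, h]

theorem sheetSum_eq_of_unique {δ : C(Circ, S)} {A : Set Circ} {q : S} {φ : Circ} (hφ : φ ∈ A) (hq : δ φ = q)
    (h : ∀ ψ, δ ψ = q → ψ = φ) : sheetSum δ A q = sheet δ φ := by
  have : {θ | θ ∈ A ∧ δ θ = q} = {φ} := by
    ext ψ
    constructor
    · exact fun h' => h ψ h'.2
    · rintro rfl
      exact ⟨hφ, hq⟩
  ext y
  simp [sheetSum, this]

theorem sheetSum_eq_zero {δ : C(Circ, S)} {A : Set Circ} {q : S} (h : ∀ ψ ∈ A, δ ψ ≠ q) :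
    sheetSum δ A q = 0 := by
  have : {θ | θ ∈ A ∧ δ θ = q} = ∅ := by
    ext ψ
    simp only [mem_ofPred_eq, mem_empty_iff_false, iff_false, not_and]
    exact fun h' => h ψ h'
  ext y
  simp [sheetSum, this]

variable [IsManifold (𝓡 2) ∞ S] [T2Space S] {δ : C(Circ, S)}

/-- Each parameter near the fiber of `x` belongs to exactly one of the finitely many strands through
`x`. Such a strand either passes through `q`, where its sheet agrees with the sheet there, or misses
`q` and contributes a constant. The hypothesis `hA` says that the part over `A` neither starts nor
ends at `x`. -/
theorem sheetSum_eventually (hδ : IsImmersedLoop δ) (hS : IsOrientedAtlas S) {A : Set Circ} {x : S}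
    (hA : ∀ θ, δ θ = x → A ∈ 𝓝 θ ∨ Aᶜ ∈ 𝓝 θ) :
    ∀ᶠ q in 𝓝 x, EqUpToConst q (sheetSum δ A x) (sheetSum δ A q) := by
  classical
  set F := (hδ.finite_fiber x).toFinset with hF
  have hFmem : ∀ θ, θ ∈ F ↔ δ θ = x := fun θ => by simp [hF]
  obtain ⟨U, hU, hdisj⟩ := F.finite_toSet.t2_separation
  choose N₀ hN₀ hstrand using hδ.exists_strand_nhds hS
  -- The neighborhoods are disjoint, and each lies entirely inside or entirely outside `A`.
  set N : Circ → Set Circ := fun θ =>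
    U θ ∩ N₀ θ ∩ (if A ∈ 𝓝 θ then A else if Aᶜ ∈ 𝓝 θ then Aᶜ else univ) with hN
  have hNmem : ∀ θ ∈ F, N θ ∈ 𝓝 θ := fun θ _ => by
    refine inter_mem (inter_mem ((hU θ).2.mem_nhds (hU θ).1) (hN₀ θ)) ?_
    split_ifs with h1 h2
    · exact h1
    · exact h2
    · exact univ_mem
  have hNA : ∀ θ ∈ F, (θ ∈ A ∧ N θ ⊆ A) ∨ (θ ∉ A ∧ N θ ⊆ Aᶜ) := fun θ hθ => by
    rcases hA θ ((hFmem θ).1 hθ) with h | h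
    · refine Or.inl ⟨mem_of_mem_nhds h, fun φ hφ => ?_⟩
      simpa [hN, h] using hφ.2
    · have h1 : θ ∉ A := mem_of_mem_nhds h
      have h2 : A ∉ 𝓝 θ := fun h' => h1 (mem_of_mem_nhds h')
      refine Or.inr ⟨h1, fun φ hφ => ?_⟩
      have := hφ.2
      rwa [if_neg h2, if_pos h] at this
  have hNdisj : (F : Set Circ).PairwiseDisjoint N := fun θ hθ φ hφ hne =>
    (hdisj hθ hφ hne).mono (fun _ h => h.1.1) (fun _ h => h.1.1)
  have e1 := eventually_fiber_subset δ x (V := ⋃ θ ∈ F, N θ) fun θ hθ =>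
    mem_of_superset (hNmem θ ((hFmem θ).2 hθ)) (subset_biUnion_of_mem (u := N) ((hFmem θ).2 hθ))
  have e2 := (eventually_all_finset F).2 fun θ hθ => by
    have := hstrand θ (N θ) (hNmem θ hθ) (fun _ h => h.1.2)
    rwa [(hFmem θ).1 hθ] at this
  filter_upwards [e1, e2] with q h1 h2
  have hleft : sheetSum δ A x = fun y => ∑ θ ∈ F, if θ ∈ A then sheet δ θ y else 0 := by
    ext y
    rw [← Finset.sum_filter, sheetSum, finsum_mem_eq_sum_of_inter_support_eq]
    ext θ
    simp [hFmem, and_comm]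
  have hright : sheetSum δ A q =
      fun y => ∑ θ ∈ F, ∑ᶠ φ ∈ {φ | φ ∈ A ∧ δ φ = q} ∩ N θ, sheet δ φ y := by
    ext y
    have hfin : ∀ θ ∈ (F : Set Circ), ({φ | φ ∈ A ∧ δ φ = q} ∩ N θ).Finite := fun θ _ =>
      (hδ.finite_fiber q).subset fun φ hφ => hφ.1.2
    have := finsum_mem_biUnion (f := fun φ => sheet δ φ y)
      (hNdisj.mono fun θ => (inter_subset_right : {φ | φ ∈ A ∧ δ φ = q} ∩ N θ ⊆ N θ))
      F.finite_toSet hfin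
    rw [finsum_mem_coe_finset] at this
    rw [← this, sheetSum]
    refine finsum_mem_congr ?_ fun _ _ => rfl
    ext φ
    simp only [mem_ofPred_eq, Finset.mem_coe, mem_iUnion, mem_inter_iff, exists_prop]
    constructor
    · intro h
      obtain ⟨θ, hθ, hφ⟩ := mem_iUnion₂.1 (h1 φ h.2)
      exact ⟨θ, hθ, h, hφ⟩
    · rintro ⟨θ, hθ, h, hφ⟩
      exact h
  rw [hleft, hright]
  refine EqUpToConst.sum F fun θ hθ => ?_
  rcases hNA θ hθ with ⟨hθA, hsub⟩ | ⟨hθA, hsub⟩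
  · simp only [hθA, if_true]
    rcases h2 θ hθ with ⟨φ, hφ, hφq, huniq, heq⟩ | ⟨hne, c, hc⟩
    · have : {φ | φ ∈ A ∧ δ φ = q} ∩ N θ = {φ} := by
        ext ψ
        constructor
        · rintro ⟨⟨-, h3⟩, h4⟩
          exact huniq ψ h4 h3
        · rintro rfl
          exact ⟨⟨hsub hφ, hφq⟩, hφ⟩
      simp only [this, finsum_mem_singleton]
      exact EqUpToConst.of_eventuallyEq heq
    · have : {φ | φ ∈ A ∧ δ φ = q} ∩ N θ = ∅ := by
        ext ψ
        simp only [mem_inter_iff, mem_ofPred_eq, mem_empty_iff_false, iff_false]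
        rintro ⟨⟨-, h3⟩, h4⟩
        exact hne ψ h4 h3
      simp only [this, finsum_mem_empty]
      exact ⟨c, by simpa using hc⟩
  · have : {φ | φ ∈ A ∧ δ φ = q} ∩ N θ = ∅ := by
      ext ψ
      simp only [mem_inter_iff, mem_ofPred_eq, mem_empty_iff_false, iff_false]
      rintro ⟨⟨h3, -⟩, h4⟩
      exact hsub h4 h3
    simp only [hθA, if_false, this, finsum_mem_empty]
    exact EqUpToConst.of_eventuallyEq (Eventually.of_forall fun _ => rfl)

theorem coherent_sheetSum_univ (hδ : IsImmersedLoop δ) (hS : IsOrientedAtlas S) :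
    Coherent (sheetSum δ univ) := fun _ =>
  sheetSum_eventually hδ hS fun _ _ => Or.inl univ_mem

/-- `A` is an arc of the circle from `u` to `o`. -/
structure IsArc (A : Set Circ) (u o : Circ) : Prop where
  mem_nhds : ∀ θ, θ ≠ u → θ ≠ o → A ∈ 𝓝 θ ∨ Aᶜ ∈ 𝓝 θ
  at_start : ∀ᶠ h : ℝ in 𝓝[>] 0, u + (h : Circ) ∈ A ∧ u - (h : Circ) ∉ A
  at_end : ∀ᶠ h : ℝ in 𝓝[>] 0, o - (h : Circ) ∈ A ∧ o + (h : Circ) ∉ A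

theorem eventually_circ_of_eventually_nhdsGT {θ : Circ} {p : Circ → Prop} (h0 : p θ)
    (h : ∀ᶠ h : ℝ in 𝓝[>] 0, p (θ + (h : Circ)) ∧ p (θ - (h : Circ))) : ∀ᶠ φ in 𝓝 θ, p φ := by
  obtain ⟨ε, hε, h⟩ := eventually_nhdsGT_zero_iff.1 h
  rw [eventually_circ, Metric.eventually_nhds_iff]
  refine ⟨ε, hε, fun k hk => ?_⟩
  rw [Real.dist_eq, sub_zero] at hk
  rcases lt_trichotomy k 0 with hk0 | rfl | hk0
  · have := (h (-k) (by linarith) (by rwa [abs_of_neg hk0] at hk)).2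
    simpa using this
  · simpa using h0
  · exact (h k hk0 (by rwa [abs_of_pos hk0] at hk)).1

theorem det₂_swap (v w : Plane) : det₂ w v = -det₂ v w := by
  simp only [det₂]
  ring

/-- The germ of a sector of a corner, in terms of the branch with sheet `a`, where the other branch
is on the side given by `b`. -/
theorem corner_arith {d : ℝ} {a : ℤ} :
    ((if 0 < d then a * (if 0 < d then 1 else 0) else
      a + (if 0 < d then 1 else 0) - a * (if 0 < d then 1 else 0)) = a) ∧
    ((if 0 < d then a * (if 0 < d then 0 else 1) else
      a + (if 0 < d then 0 else 1) - a * (if 0 < d then 0 else 1)) = if 0 < d then 0 else 1) := by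
  split_ifs <;> simp

/-- Away from the corner this is `sheetSum_eventually`. A point near the corner but different from
it lies on at most one of the two branches. The sheet of the other branch is constant there, with a
value that tells whether the parameter belongs to `A`. By `corner_arith` the sector germ then jumps
on the half of the branch in `A` and is constant on the other half. -/
theorem coherent_cornerSum (hδ : IsImmersedLoop δ) (hS : IsOrientedAtlas S) {A : Set Circ}
    {u o : Circ} (hA : IsArc A u o) (huo : δ u = δ o)
    (hfib : ∀ θ, δ θ = δ u → θ = u ∨ θ = o)
    (hd : det₂ (velocity δ u) (velocity δ o) ≠ 0) : Coherent (cornerSum δ A u o) := by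
  intro x
  by_cases hx : x = δ u
  swap
  · have h1 : ∀ᶠ q in 𝓝 x, q ≠ δ u := isOpen_ne.mem_nhds hx
    filter_upwards [h1, sheetSum_eventually hδ hS (A := A) (x := x) fun θ hθ =>
      hA.mem_nhds θ (fun h => hx (by rw [← hθ, h])) (fun h => hx (by rw [← hθ, h, huo]))]
      with q h2 h3
    rwa [cornerSum_of_ne h2, cornerSum_of_ne hx]
  subst hx
  set d := det₂ (velocity δ u) (velocity δ o) with hddef
  have hd' : det₂ (velocity δ o) (velocity δ u) = -d := det₂_swap _ _
  obtain ⟨hu, No', hNo', hsep⟩ := hδ.sheet_of_transverse hS hδ.smooth huo hd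
  obtain ⟨ho, -⟩ := hδ.sheet_of_transverse hS hδ.smooth huo.symm (by rw [hd']; exact neg_ne_zero.2 hd)
  rw [hd'] at ho
  rw [← hddef] at hu
  obtain ⟨Nu₀, hNu₀, hstu⟩ := hδ.exists_strand_nhds hS u
  obtain ⟨No₀, hNo₀, hsto⟩ := hδ.exists_strand_nhds hS o
  -- Just after `u` the curve is in `A` and on the right of the branch at `o` exactly if `0 < d`.
  -- Just before `u` it is outside `A` and on the opposite side.
  have hMu : ∀ᶠ φ in 𝓝 u, φ = u ∨ ((∀ ψ ∈ No', δ ψ ≠ δ φ) ∧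
      ((φ ∈ A ∧ ∀ᶠ y in 𝓝 (δ φ), sheet δ o y = if 0 < d then 1 else 0) ∨
      (φ ∉ A ∧ ∀ᶠ y in 𝓝 (δ φ), sheet δ o y = if 0 < d then 0 else 1))) := by
    refine eventually_circ_of_eventually_nhdsGT (Or.inl rfl) ?_
    filter_upwards [hu, hsep, hA.at_start] with h h1 h2 h3
    exact ⟨Or.inr ⟨fun ψ hψ => (h2 ψ hψ).1, Or.inl ⟨h3.1, h1.1⟩⟩,
      Or.inr ⟨fun ψ hψ => (h2 ψ hψ).2, Or.inr ⟨h3.2, h1.2⟩⟩⟩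
  have hif : ∀ a b : ℤ, (if 0 < -d then a else b) = if 0 < d then b else a := fun a b => by
    rcases lt_or_gt_of_ne hd with h | h
    · rw [if_pos (by linarith), if_neg (by linarith)]
    · rw [if_neg (by linarith), if_pos h]
  have hMo : ∀ᶠ φ in 𝓝 o, φ = o ∨
      ((φ ∈ A ∧ ∀ᶠ y in 𝓝 (δ φ), sheet δ u y = if 0 < d then 1 else 0) ∨
      (φ ∉ A ∧ ∀ᶠ y in 𝓝 (δ φ), sheet δ u y = if 0 < d then 0 else 1)) := by
    refine eventually_circ_of_eventually_nhdsGT (Or.inl rfl) ?_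
    filter_upwards [ho, hA.at_end] with h h1 h3
    simp only [hif] at h1
    exact ⟨Or.inr (Or.inr ⟨h3.2, h1.1⟩), Or.inr (Or.inl ⟨h3.1, h1.2⟩)⟩
  have hNu := inter_mem hNu₀ hMu
  have hNo := inter_mem (inter_mem hNo₀ hNo') hMo
  have e1 := eventually_fiber_subset δ (δ u) (V := (Nu₀ ∩ {φ | φ = u ∨ ((∀ ψ ∈ No', δ ψ ≠ δ φ) ∧
      ((φ ∈ A ∧ ∀ᶠ y in 𝓝 (δ φ), sheet δ o y = if 0 < d then 1 else 0) ∨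
      (φ ∉ A ∧ ∀ᶠ y in 𝓝 (δ φ), sheet δ o y = if 0 < d then 0 else 1)))}) ∪
      (No₀ ∩ No' ∩ {φ | φ = o ∨
      ((φ ∈ A ∧ ∀ᶠ y in 𝓝 (δ φ), sheet δ u y = if 0 < d then 1 else 0) ∨
      (φ ∉ A ∧ ∀ᶠ y in 𝓝 (δ φ), sheet δ u y = if 0 < d then 0 else 1))})) fun θ hθ => by
    rcases hfib θ hθ with rfl | rfl
    · exact mem_of_superset hNu subset_union_left
    · exact mem_of_superset hNo subset_union_right
  have e2 := hstu _ hNu inter_subset_left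
  have e3 := hsto _ hNo fun _ h => h.1.1
  rw [← huo] at e3
  filter_upwards [e1, e2, e3] with q hq1 hq2 hq3
  by_cases hq : q = δ u
  · rw [hq]
    exact EqUpToConst.of_eventuallyEq (Eventually.of_forall fun _ => rfl)
  rw [cornerSum_of_ne hq]
  have hp : cornerSum δ A u o (δ u) = fun y =>
      if 0 < d then sheet δ u y * sheet δ o y
      else sheet δ u y + sheet δ o y - sheet δ u y * sheet δ o y := by
    ext y
    simp only [cornerSum, if_true, ← hddef]
  rw [hp]
  rcases hq2 with ⟨φ, hφ, rfl, huniq, heq⟩ | ⟨hne, c, hc⟩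
  · rcases hφ.2 with rfl | ⟨hsep', hside⟩
    · exact absurd rfl hq
    have hall : ∀ ψ, δ ψ = δ φ → ψ = φ := fun ψ hψ => by
      rcases hq1 ψ hψ with h | h
      · exact huniq ψ h hψ
      · exact absurd hψ (hsep' ψ h.1.2)
    rcases hside with ⟨hφA, hside⟩ | ⟨hφA, hside⟩
    · rw [sheetSum_eq_of_unique hφA rfl hall]
      refine EqUpToConst.of_eventuallyEq ?_
      filter_upwards [heq, hside] with y h1 h2
      rw [← h1, h2, corner_arith.1]
    · rw [sheetSum_eq_zero fun ψ hψ h => hφA (hall ψ h ▸ hψ)]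
      refine ⟨if 0 < d then 0 else 1, ?_⟩
      filter_upwards [hside] with y h2
      rw [h2, corner_arith.2, Pi.zero_apply, add_zero]
  · rcases hq3 with ⟨φ, hφ, rfl, huniq, heq⟩ | ⟨hne', c', hc'⟩
    · rcases hφ.2 with rfl | hside
      · exact absurd huo.symm hq
      have hall : ∀ ψ, δ ψ = δ φ → ψ = φ := fun ψ hψ => by
        rcases hq1 ψ hψ with h | h
        · exact absurd hψ (hne ψ h)
        · exact huniq ψ h hψ
      have hcomm : ∀ y, (if 0 < d then sheet δ u y * sheet δ o y
          else sheet δ u y + sheet δ o y - sheet δ u y * sheet δ o y) =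
          if 0 < d then sheet δ o y * sheet δ u y
          else sheet δ o y + sheet δ u y - sheet δ o y * sheet δ u y := fun y => by
        split_ifs <;> ring
      simp only [hcomm]
      rcases hside with ⟨hφA, hside⟩ | ⟨hφA, hside⟩
      · rw [sheetSum_eq_of_unique hφA rfl hall]
        refine EqUpToConst.of_eventuallyEq ?_
        filter_upwards [heq, hside] with y h1 h2
        rw [← h1, h2, corner_arith.1]
      · rw [sheetSum_eq_zero fun ψ hψ h => hφA (hall ψ h ▸ hψ)]
        refine ⟨if 0 < d then 0 else 1, ?_⟩
        filter_upwards [hside] with y h2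
        rw [h2, corner_arith.2, Pi.zero_apply, add_zero]
    -- Off both branches the two sheets are constant, and so is their combination.
    · rw [sheetSum_eq_zero fun ψ _ h => (hq1 ψ h).elim (fun h' => hne ψ h' h)
        fun h' => hne' ψ h' h]
      refine ⟨if 0 < d then c * c' else c + c' - c * c', ?_⟩
      filter_upwards [hc, hc'] with y h1 h2
      rw [h1, h2, Pi.zero_apply, add_zero]

end Germs

theorem eventually_eq_of_continuousAt_intCast {X : Type*} [TopologicalSpace X] {n : X → ℤ} {x : X}
    (h : ContinuousAt (fun y => (n y : ℝ)) x) : ∀ᶠ y in 𝓝 x, n y = n x := by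
  filter_upwards [Metric.tendsto_nhds.1 h 1 one_pos] with y hy
  rw [Real.dist_eq, ← Int.cast_sub, ← Int.cast_abs] at hy
  have : |n y - n x| < 1 := by exact_mod_cast hy
  rw [Int.abs_lt_one_iff] at this
  omega

theorem finsum_Ioc_coe (J : Circ → ℤ) {x y : ℝ} (h : y ≤ x + 1) :
    ∑ᶠ t ∈ Ioc x y, J (t : Circ) = ∑ᶠ θ ∈ (fun t : ℝ => (t : Circ)) '' Ioc x y, J θ :=
  (finsum_mem_image ((coe_injOn_Ioc x).mono (Ioc_subset_Ioc_right h))).symm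

/-! ### Intersection counts as degrees -/

section Counting

variable {S : Type*} [TopologicalSpace S] [ChartedSpace Plane S] [IsManifold (𝓡 2) ∞ S] [T2Space S]
  {γ δ : C(Circ, S)}

/-- The sign of the intersections of `γ` at the parameter `φ` with the strands of `δ` with
parameters in `A`. -/
def strandJump (γ δ : C(Circ, S)) (A : Set Circ) (φ : Circ) : ℤ :=
  ∑ᶠ θ ∈ {θ | θ ∈ A ∧ δ θ = γ φ}, intersectionSign γ δ φ θ

/-- Immediately before and after an intersection, `γ` is off each of the finitely many strands
through it. The parameters of `γ` on `δ` are therefore isolated, and the fibers of `δ` are finite.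
-/
theorem finite_intersections (hδ : IsImmersedLoop δ) (hS : IsOrientedAtlas S)
    (hγ : SmoothCurve γ) (ht : TransverseCurves γ δ) :
    {p : Circ × Circ | γ p.1 = δ p.2}.Finite := by
  have h1 : ({φ | γ φ ∈ range δ} ∩ univ).Finite := by
    refine finite_of_isCompact_of_isolated isCompact_univ fun φ _ => ?_
    have hN : ∀ θ, ∃ N : Set Circ, γ φ = δ θ → N ∈ 𝓝 θ ∧ ∀ᶠ h : ℝ in 𝓝[>] 0, ∀ ψ ∈ N,
        δ ψ ≠ γ (φ + (h : Circ)) ∧ δ ψ ≠ γ (φ - (h : Circ)) := fun θ => by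
      by_cases h : γ φ = δ θ
      · obtain ⟨N, hN, hN'⟩ := (hδ.sheet_of_transverse hS hγ h (ht φ θ h)).2
        exact ⟨N, fun _ => ⟨hN, hN'⟩⟩
      · exact ⟨∅, fun h' => absurd h' h⟩
    choose N hN using hN
    set F := (hδ.finite_fiber (γ φ)).toFinset with hF
    have hFmem : ∀ θ, θ ∈ F ↔ δ θ = γ φ := fun θ => by simp [hF]
    have e1 := eventually_fiber_subset δ (γ φ) (V := ⋃ θ ∈ F, N θ) fun θ hθ =>
      mem_of_superset (hN θ hθ.symm).1 (subset_biUnion_of_mem (u := N) ((hFmem θ).2 hθ))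
    have e2 := (eventually_all_finset F).2 fun θ hθ => (hN θ ((hFmem θ).1 hθ).symm).2
    have e3 := eventually_circ.1 (γ.continuous.continuousAt.eventually e1)
    have hneg : Tendsto (fun h : ℝ => -h) (𝓝 0) (𝓝 0) := by
      simpa using (continuous_neg (G := ℝ)).tendsto 0
    have e4 := hneg.eventually e3
    rw [eventually_nhdsWithin_iff]
    refine eventually_circ_of_eventually_nhdsGT (fun h => absurd rfl h) ?_
    filter_upwards [e2, eventually_nhdsWithin_of_eventually_nhds e3,
      eventually_nhdsWithin_of_eventually_nhds e4] with h h2 h3 h4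
    simp only [AddCircle.coe_neg, ← sub_eq_add_neg] at h4
    constructor
    · rintro - ⟨ψ, hψ⟩
      obtain ⟨θ, hθ, hψN⟩ := mem_iUnion₂.1 (h3 ψ hψ)
      exact (h2 θ hθ ψ hψN).1 hψ
    · rintro - ⟨ψ, hψ⟩
      obtain ⟨θ, hθ, hψN⟩ := mem_iUnion₂.1 (h4 ψ hψ)
      exact (h2 θ hθ ψ hψN).2 hψ
  rw [inter_univ] at h1
  refine (h1.biUnion fun φ _ => (hδ.finite_fiber (γ φ)).image fun θ => (φ, θ)).subset ?_
  rintro ⟨φ, θ⟩ h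
  exact mem_biUnion (show γ φ ∈ range δ from ⟨θ, h.symm⟩) ⟨θ, h.symm, rfl⟩

theorem finsum_strandJump_eq (hδ : IsImmersedLoop δ) (hS : IsOrientedAtlas S)
    (hγ : SmoothCurve γ) (ht : TransverseCurves γ δ) (A : Set Circ) :
    ∑ᶠ φ, strandJump γ δ A φ =
      ∑ᶠ p ∈ {p : Circ × Circ | p.2 ∈ A ∧ γ p.1 = δ p.2}, intersectionSign γ δ p.1 p.2 := by
  rw [finsum_mem_def, finsum_curry]
  · refine finsum_congr fun φ => ?_
    rw [strandJump, finsum_mem_def]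
    refine finsum_congr fun θ => ?_
    by_cases h : θ ∈ A ∧ γ φ = δ θ
    · rw [indicator_of_mem (show θ ∈ {θ | θ ∈ A ∧ δ θ = γ φ} from ⟨h.1, h.2.symm⟩),
        indicator_of_mem (show (φ, θ) ∈ {p : Circ × Circ | p.2 ∈ A ∧ γ p.1 = δ p.2} from h)]
    · rw [indicator_of_notMem fun h' => h ⟨h'.1, h'.2.symm⟩,
        indicator_of_notMem (show (φ, θ) ∉ {p : Circ × Circ | p.2 ∈ A ∧ γ p.1 = δ p.2} from h)]
  · refine (finite_intersections hδ hS hγ ht).subset fun p hp => ?_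
    by_contra h
    exact hp (indicator_of_notMem (fun h' => h h'.2) _)

theorem finsum_strandJump_univ (hδ : IsImmersedLoop δ) (hS : IsOrientedAtlas S)
    (hγ : SmoothCurve γ) (ht : TransverseCurves γ δ) :
    ∑ᶠ φ, strandJump γ δ univ φ = signedCount γ δ := by
  rw [finsum_strandJump_eq hδ hS hγ ht, signedCount]
  simp

/-- One sum over pairs of parameters, arranged along `δ` on the left and along `γ` on the right. The
left side measures changes of color, the right side is what a degree computes. -/
theorem finsum_mem_jump_eq (hδ : IsImmersedLoop δ) (hS : IsOrientedAtlas S)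
    (hγ : SmoothCurve γ) (ht : TransverseCurves γ δ) (A : Set Circ) :
    ∑ᶠ θ ∈ A, ∑ᶠ φ ∈ {φ | γ φ = δ θ}, intersectionSign γ δ φ θ =
      ∑ᶠ φ, strandJump γ δ A φ := by
  rw [finsum_strandJump_eq hδ hS hγ ht, finsum_mem_def, finsum_mem_def,
    ← finsum_comp_equiv (Equiv.prodComm Circ Circ), finsum_curry]
  · refine finsum_congr fun θ => ?_
    by_cases hθ : θ ∈ A
    · rw [indicator_of_mem hθ, finsum_mem_def]
      refine finsum_congr fun φ => ?_
      by_cases h : γ φ = δ θ <;> simp [indicator, h, hθ]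
    · rw [indicator_of_notMem hθ, finsum_eq_zero_of_forall_eq_zero]
      intro φ
      simp [hθ]
  · refine ((finite_intersections hδ hS hγ ht).preimage
      (Equiv.prodComm Circ Circ).injective.injOn).subset fun p hp => ?_
    by_contra h
    exact hp (indicator_of_notMem (fun h' => h h'.2) _)

theorem strandJump_hasJumps (hδ : IsImmersedLoop δ) (hS : IsOrientedAtlas S)
    (hγ : SmoothCurve γ) (ht : TransverseCurves γ δ) {A : Set Circ} {K : ℝ → ℤ}
    (hK : ∀ t : ℝ, ∃ n : ℤ, ∀ᶠ h : ℝ in 𝓝 0,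
      K (t + h) = n + sheetSum δ A (γ (t : Circ)) (γ ((t : Circ) + (h : Circ)))) :
    HasJumps K fun t => strandJump γ δ A (t : Circ) := by
  classical
  intro t
  obtain ⟨n, hn⟩ := hK t
  have hneg : Tendsto (fun h : ℝ => -h) (𝓝 0) (𝓝 0) := by
    simpa using (continuous_neg (G := ℝ)).tendsto 0
  have hn' := hneg.eventually hn
  have hfin : {θ | θ ∈ A ∧ δ θ = γ (t : Circ)}.Finite :=
    (hδ.finite_fiber (γ (t : Circ))).subset fun θ h => h.2
  have hF : ∀ θ, θ ∈ hfin.toFinset ↔ θ ∈ A ∧ δ θ = γ (t : Circ) := fun θ => by simp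
  have hsum : ∀ y, sheetSum δ A (γ (t : Circ)) y = ∑ θ ∈ hfin.toFinset, sheet δ θ y := fun y => by
    rw [sheetSum, finsum_mem_eq_finite_toFinset_sum _ hfin]
  have hjump : strandJump γ δ A (t : Circ) =
      ∑ θ ∈ hfin.toFinset, intersectionSign γ δ (t : Circ) θ := by
    rw [strandJump, finsum_mem_eq_finite_toFinset_sum _ hfin]
  have e := (eventually_all_finset hfin.toFinset).2 fun θ hθ =>
    (hδ.sheet_of_transverse hS hγ ((hF θ).1 hθ).2.symm (ht _ _ ((hF θ).1 hθ).2.symm)).1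
  -- The value before the crossing: at a positive intersection `γ` arrives from the left, where the
  -- sheet is `0`, and at a negative one from the right.
  refine ⟨n + ∑ θ ∈ hfin.toFinset,
    if 0 < det₂ (velocity γ (t : Circ)) (velocity δ θ) then 0 else 1, ?_⟩
  filter_upwards [e, eventually_nhdsWithin_of_eventually_nhds hn,
    eventually_nhdsWithin_of_eventually_nhds hn'] with h h1 h2 h3
  simp only [AddCircle.coe_neg, ← sub_eq_add_neg] at h3
  rw [h2, h3, hsum, hsum, hjump, add_assoc, ← Finset.sum_add_distrib]
  refine ⟨congrArg _ (Finset.sum_congr rfl fun θ hθ => (h1 θ hθ).2.self_of_nhds),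
    congrArg _ (Finset.sum_congr rfl fun θ hθ => ?_)⟩
  rw [(h1 θ hθ).1.self_of_nhds, intersectionSign]
  rcases lt_or_gt_of_ne (ht _ _ ((hF θ).1 hθ).2.symm) with hd | hd
  · rw [if_neg (by linarith), if_neg (by linarith), sign_neg hd]
    rfl
  · rw [if_pos hd, if_pos hd, sign_pos hd]
    rfl

/-- The signed number of intersections of `γ` with the part of `δ` over `A` is a degree. -/
theorem finsum_strandJump_eq_degree (hδ : IsImmersedLoop δ) (hS : IsOrientedAtlas S)
    (hγ : SmoothCurve γ) (ht : TransverseCurves γ δ) {A : Set Circ} {u : S → ℝ} {g : S → S → ℤ}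
    (hu : IsPotential u g) (hg : ∀ φ, g (γ φ) = sheetSum δ A (γ φ)) :
    ((∑ᶠ φ, strandJump γ δ A φ : ℤ) : ℝ) = -circleDegree (hu.toCircle.comp γ) := by
  obtain ⟨L, hL⟩ := exists_isLift (hu.toCircle.comp γ)
  have hK : ∀ t : ℝ, ∃ n : ℤ, u (γ (t : Circ)) - L t = n := fun t => by
    refine exists_int_of_coe_eq_zero ?_
    rw [AddCircle.coe_sub, hL.2]
    simp
  -- The integer function `K = u ∘ γ - L` inherits the jumps of `u ∘ γ`, because `L` is continuous.
  choose K hK using hK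
  have hloc : ∀ t : ℝ, ∃ n : ℤ, ∀ᶠ h : ℝ in 𝓝 0,
      K (t + h) = n + sheetSum δ A (γ (t : Circ)) (γ ((t : Circ) + (h : Circ))) := fun t => by
    set n : ℝ → ℤ := fun h => K (t + h) - g (γ (t : Circ)) (γ ((t : Circ) + (h : Circ))) with hn
    have hcont : ContinuousAt (fun h => (n h : ℝ)) 0 := by
      have h1 : ContinuousAt (fun h : ℝ => u (γ ((t : Circ) + (h : Circ))) -
          g (γ (t : Circ)) (γ ((t : Circ) + (h : Circ)))) 0 := by
        have h2 : Tendsto (fun h : ℝ => γ ((t : Circ) + (h : Circ))) (𝓝 0) (𝓝 (γ (t : Circ))) :=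
          γ.continuous.continuousAt.tendsto.comp (tendsto_circ_add _)
        have h3 := (hu (γ (t : Circ))).tendsto.comp h2
        rw [ContinuousAt]
        simpa [Function.comp_def] using h3
      refine (h1.sub (g := fun h => L (t + h))
        (hL.1.continuousAt.comp (by fun_prop))).congr (Eventually.of_forall fun h => ?_)
      simp only [hn, Pi.sub_apply, Int.cast_sub, ← hK, AddCircle.coe_add]
      ring
    refine ⟨n 0, (eventually_eq_of_continuousAt_intCast hcont).mono fun h hh => ?_⟩
    rw [← hh, ← hg]
    simp only [hn]
    ring
  have hjumps := strandJump_hasJumps hδ hS hγ ht hloc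
  obtain ⟨a, ha⟩ := hjumps 0
  obtain ⟨b, hb⟩ := hjumps 1
  have ha := ha.mono fun h hh => hh.2
  have hb := hb.mono fun h hh => hh.2
  have := hjumps.sub_eq_finsum zero_le_one ha hb
  have hcirc : (fun t : ℝ => (t : Circ)) '' Ioc 0 1 = univ := by
    simpa using coe_surjOn_Ioc 0
  rw [finsum_Ioc_coe (strandJump γ δ A) (by simp), hcirc, finsum_mem_univ] at this
  rw [← this]
  -- Over one period `u ∘ γ` returns to its value while `L` grows by the degree. This is the source
  -- of the minus sign.
  obtain ⟨h, h1, h2⟩ := (ha.and hb).exists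
  have e1 := hK (0 + h)
  have e2 := hK (1 + h)
  rw [h1, zero_add] at e1
  rw [h2, add_comm (1 : ℝ), hL.add_one, AddCircle.coe_add, AddCircle.coe_period, add_zero] at e2
  push_cast at e1 e2 ⊢
  linarith

end Counting

/-! ### Arcs of the circle -/

section Arcs

/-- The half open arc of the circle traced by the interval `(a, b]`. -/
def circArc (a b : ℝ) : Set Circ := (fun t : ℝ => (t : Circ)) '' Ioc a b

theorem exists_coe_Ioc (a : ℝ) (θ : Circ) : ∃ t ∈ Ioc a (a + 1), (t : Circ) = θ := by
  have : θ ∈ (fun t : ℝ => (t : Circ)) '' Ioc a (a + 1) := by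
    rw [coe_surjOn_Ioc]
    trivial
  exact this

theorem isOpen_coe_image {U : Set ℝ} (hU : IsOpen U) :
    IsOpen ((fun t : ℝ => (t : Circ)) '' U) :=
  (AddCircle.isLocalHomeomorph_coe (1 : ℝ)).isOpenMap U hU

theorem coe_mem_circArc {a b t : ℝ} (hba : b ≤ a + 1) (ht : t ∈ Ioc a (a + 1)) :
    (t : Circ) ∈ circArc a b ↔ t ≤ b := by
  constructor
  · rintro ⟨s, hs, hst⟩
    rw [← coe_injOn_Ioc a ⟨hs.1, hs.2.trans hba⟩ ht hst]
    exact hs.2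
  · exact fun h => ⟨t, ⟨ht.1, h⟩, rfl⟩

theorem coe_add_one (t : ℝ) : ((t + 1 : ℝ) : Circ) = t := by
  rw [AddCircle.coe_add, AddCircle.coe_period, add_zero]

theorem isArc_circArc {a b : ℝ} (hab : a < b) (hba : b < a + 1) :
    IsArc (circArc a b) (a : Circ) (b : Circ) := by
  refine ⟨fun θ ha hb => ?_, ?_, ?_⟩
  · obtain ⟨t, ht, rfl⟩ := exists_coe_Ioc a θ
    have h1 : t ≠ a + 1 := fun h => ha (by rw [h, coe_add_one])
    have h2 : t ≠ b := fun h => hb (by rw [h])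
    rcases lt_or_gt_of_ne h2 with h | h
    · refine Or.inl (mem_of_superset ((isOpen_coe_image isOpen_Ioo).mem_nhds
        ⟨t, ⟨ht.1, h⟩, rfl⟩) (image_mono Ioo_subset_Ioc_self))
    · refine Or.inr (mem_of_superset ((isOpen_coe_image isOpen_Ioo).mem_nhds
        ⟨t, ⟨h, lt_of_le_of_ne ht.2 h1⟩, rfl⟩) ?_)
      rintro _ ⟨s, hs, rfl⟩ hmem
      exact absurd ((coe_mem_circArc hba.le ⟨hab.trans hs.1, hs.2.le⟩).1 hmem) (not_le.2 hs.1)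
  · refine eventually_nhdsGT_zero_iff.2 ⟨min (b - a) (a + 1 - b),
      lt_min (by linarith) (by linarith), fun h h0 h1 => ?_⟩
    have h2 := lt_min_iff.1 h1
    constructor
    · exact ⟨a + h, ⟨by linarith, by linarith⟩, by simp⟩
    · have : (a : Circ) - (h : Circ) = ((a + 1 - h : ℝ) : Circ) := by
        rw [AddCircle.coe_sub, coe_add_one]
      rw [this, coe_mem_circArc hba.le ⟨by linarith, by linarith⟩]
      linarith
  · refine eventually_nhdsGT_zero_iff.2 ⟨min (b - a) (a + 1 - b),
      lt_min (by linarith) (by linarith), fun h h0 h1 => ?_⟩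
    have h2 := lt_min_iff.1 h1
    constructor
    · exact ⟨b - h, ⟨by linarith, by linarith⟩, by simp⟩
    · rw [← AddCircle.coe_add, coe_mem_circArc hba.le ⟨by linarith, by linarith⟩]
      linarith

/-- The parameters of two points in disjoint arcs have lifts to the line for which the pieces of the
circle between points of these arcs agree outside of the arcs. -/
theorem exists_lifts_of_disjoint_arcs {l r l' r' : ℝ}
    (hdisj : Disjoint ((fun t : ℝ => (t : Circ)) '' Icc l r)
      ((fun t : ℝ => (t : Circ)) '' Icc l' r'))
    {u₁ o₁ u₂ o₂ : Circ} (hu₁ : u₁ ∈ (fun t : ℝ => (t : Circ)) '' Icc l r)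
    (ho₁ : o₁ ∈ (fun t : ℝ => (t : Circ)) '' Icc l' r')
    (hu₂ : u₂ ∈ (fun t : ℝ => (t : Circ)) '' Icc l r)
    (ho₂ : o₂ ∈ (fun t : ℝ => (t : Circ)) '' Icc l' r') :
    ∃ a₁ b₁ a₂ b₂ : ℝ, (a₁ : Circ) = u₁ ∧ (b₁ : Circ) = o₁ ∧ (a₂ : Circ) = u₂ ∧ (b₂ : Circ) = o₂ ∧
      a₁ < b₁ ∧ b₁ < a₁ + 1 ∧ a₂ < b₂ ∧ b₂ < a₂ + 1 ∧
      ∀ θ, θ ∉ (fun t : ℝ => (t : Circ)) '' Icc l r → θ ∉ (fun t : ℝ => (t : Circ)) '' Icc l' r' →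
        (θ ∈ circArc a₁ b₁ ↔ θ ∈ circArc a₂ b₂) := by
  obtain ⟨a₁, ha₁, rfl⟩ := hu₁
  obtain ⟨b₁, hb₁, rfl⟩ := ho₁
  obtain ⟨a₂, ha₂, rfl⟩ := hu₂
  obtain ⟨b₂, hb₂, rfl⟩ := ho₂
  have hne : ∀ s ∈ Icc l r, ∀ t ∈ Icc l' r', (s : Circ) ≠ t := fun s hs t ht h =>
    disjoint_left.1 hdisj ⟨s, hs, rfl⟩ ⟨t, ht, h.symm⟩
  -- Disjointness will force the whole interval `[l', r'] + n` to lie strictly between `[l, r]` and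
  -- `[l, r] + 1`, so this one shift serves both pairs.
  obtain ⟨n, hn⟩ : ∃ n : ℤ, b₁ + n ∈ Ioc a₁ (a₁ + 1) := by
    obtain ⟨t, ht, hb⟩ := exists_coe_Ioc a₁ (b₁ : Circ)
    obtain ⟨n, hn⟩ := exists_int_of_coe_eq_zero (x := t - b₁) (by rw [AddCircle.coe_sub, hb, sub_self])
    exact ⟨n, by rwa [← hn, add_sub_cancel]⟩
  have hcoe : ∀ t : ℝ, ((t + n : ℝ) : Circ) = t := fun t => by
    rw [AddCircle.coe_add, coe_int_eq_zero, add_zero]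
  have hcoe' : ∀ t : ℝ, ((t - n : ℝ) : Circ) = t := fun t => by
    rw [AddCircle.coe_sub, coe_int_eq_zero, sub_zero]
  -- Otherwise `max a₁ (l' + n)` would represent a common point of the two arcs. The next bound
  -- follows in the same way one turn later.
  have h1 : r < l' + n := by
    by_contra! h
    set x := max a₁ (l' + n)
    refine hne x ⟨ha₁.1.trans (le_max_left _ _), max_le ha₁.2 h⟩ (x - n) ⟨?_, ?_⟩ (hcoe' x).symm
    · linarith [le_max_right a₁ (l' + n)]
    · have : x ≤ b₁ + n := max_le hn.1.le (by linarith [hb₁.1])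
      linarith [hb₁.2]
  have h2 : r' + n < l + 1 := by
    by_contra! h
    set x := max (b₁ + n) (l + 1)
    refine hne (x - 1) ⟨?_, ?_⟩ (x - n) ⟨?_, ?_⟩ ?_
    · linarith [le_max_right (b₁ + n) (l + 1)]
    · have : x ≤ a₁ + 1 := max_le hn.2 (by linarith [ha₁.1])
      linarith [ha₁.2]
    · linarith [le_max_left (b₁ + n) (l + 1), hb₁.1]
    · have : x ≤ r' + n := max_le (by linarith [hb₁.2]) h
      linarith
    · rw [hcoe', ← coe_add_one, sub_add_cancel]
  have key : ∀ a ∈ Icc l r, ∀ b ∈ Icc l' r', ∀ a' ∈ Icc l r, ∀ b' ∈ Icc l' r', ∀ θ : Circ,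
      θ ∉ (fun t : ℝ => (t : Circ)) '' Icc l r → θ ∉ (fun t : ℝ => (t : Circ)) '' Icc l' r' →
        θ ∈ circArc a (b + n) → θ ∈ circArc a' (b' + n) := by
    rintro a ha b hb a' ha' b' hb' _ h3 h4 ⟨t, ht, rfl⟩
    refine ⟨t, ⟨?_, ?_⟩, rfl⟩
    · by_contra! h
      exact h3 ⟨t, ⟨ha.1.trans ht.1.le, h.trans ha'.2⟩, rfl⟩
    · by_contra! h
      exact h4 ⟨t - n, ⟨by linarith [hb'.1], by linarith [ht.2, hb.2]⟩, hcoe' t⟩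
  refine ⟨a₁, b₁ + n, a₂, b₂ + n, rfl, hcoe _, rfl, hcoe _, ?_, ?_, ?_, ?_, fun θ h3 h4 => ⟨?_, ?_⟩⟩
  · exact hn.1
  · linarith [hb₁.2, ha₁.1]
  · linarith [hb₂.1, ha₂.2]
  · linarith [hb₂.2, ha₂.1]
  · exact key a₁ ha₁ b₁ hb₁ a₂ ha₂ b₂ hb₂ θ h3 h4
  · exact key a₂ ha₂ b₂ hb₂ a₁ ha₁ b₁ hb₁ θ h3 h4

theorem exists_lifts_of_ne {u o : Circ} (h : u ≠ o) :
    ∃ a b : ℝ, (a : Circ) = u ∧ (b : Circ) = o ∧ a < b ∧ b < a + 1 := by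
  obtain ⟨a, rfl⟩ := QuotientAddGroup.mk_surjective u
  obtain ⟨b, hb, rfl⟩ := exists_coe_Ioc a o
  refine ⟨a, b, rfl, rfl, hb.1, lt_of_le_of_ne hb.2 fun h' => h ?_⟩
  rw [h', coe_add_one]

end Arcs

/-! ### Invariance of the germs under reparametrization -/

section Reparam

variable {r : Circ ≃ₜ Circ} {g : ℝ → ℝ}

theorem reparam_coe_mem_circArc (hg : StrictMono g) (hg' : Continuous g)
    (hr : ∀ t : ℝ, r (t : Circ) = (g t : Circ)) {a b : ℝ} (θ : Circ) :
    r θ ∈ circArc (g a) (g b) ↔ θ ∈ circArc a b := by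
  constructor
  · rintro ⟨s, hs, h⟩
    have hab : a ≤ b := (hg.lt_iff_lt.1 (hs.1.trans_le hs.2)).le
    obtain ⟨t, ht, rfl⟩ := intermediate_value_Ioc hab hg'.continuousOn hs
    refine ⟨t, ht, r.injective ?_⟩
    rw [← h]
    exact hr t
  · rintro ⟨t, ht, rfl⟩
    exact ⟨g t, ⟨hg ht.1, hg.monotone ht.2⟩, (hr t).symm⟩

/-- Otherwise `g` would take the value `g a + 1` at a point of `(a, b]`, and `r` would not be
injective. -/
theorem reparam_lt_add_one (hg' : Continuous g)
    (hr : ∀ t : ℝ, r (t : Circ) = (g t : Circ)) {a b : ℝ} (hab : a < b) (hba : b < a + 1) :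
    g b < g a + 1 := by
  by_contra! h
  obtain ⟨t, ht, hgt⟩ := intermediate_value_Ioc hab.le hg'.continuousOn
    (show g a + 1 ∈ Ioc (g a) (g b) from ⟨by linarith, h⟩)
  have h1 : (t : Circ) = ((a + 1 : ℝ) : Circ) := by
    apply r.injective
    rw [hr, hgt, coe_add_one, coe_add_one, hr]
  have h2 := coe_injOn_Ioc a ⟨ht.1, by linarith [ht.2]⟩ ⟨by linarith, le_rfl⟩ h1
  linarith [ht.2]

variable {S : Type*} [TopologicalSpace S] [ChartedSpace Plane S] [IsManifold (𝓡 2) ∞ S]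
  {δ δ' : C(Circ, S)}

theorem velocityIn_reparam (hδ' : SmoothCurve δ') (hg : ContDiff ℝ ∞ g)
    (hr : ∀ t : ℝ, r (t : Circ) = (g t : Circ)) {e : OpenPartialHomeomorph S Plane}
    (he : e ∈ atlas Plane S) {t : ℝ} (h : ∀ᶠ φ in 𝓝 (t : Circ), δ' (r φ) = δ φ)
    (hsrc : δ (t : Circ) ∈ e.source) :
    velocityIn e δ (t : Circ) = deriv g t • velocityIn e δ' (r (t : Circ)) := by
  have hsrc' : δ' (r (t : Circ)) ∈ e.source := by rwa [h.self_of_nhds]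
  have h1 : HasDerivAt (fun k => g (t + k) - g t) (deriv g t) 0 := by
    have h2 : HasDerivAt g (deriv g t) (t + 0) := by
      rw [add_zero]
      exact (hg.differentiable (by simp) t).hasDerivAt
    exact (h2.comp_const_add t 0).sub_const _
  have h3 : HasDerivAt (localCurve e δ' (r (t : Circ))) (velocityIn e δ' (r (t : Circ)))
      (g (t + 0) - g t) := by
    rw [add_zero, sub_self]
    exact hδ'.hasDerivAt_localCurve he hsrc'
  have h4 := HasDerivAt.scomp (0 : ℝ) h3 h1
  refine (h4.congr_of_eventuallyEq ?_).deriv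
  filter_upwards [eventually_circ.1 h] with k hk
  rw [Function.comp_apply, localCurve, localCurve, ← hk, ← AddCircle.coe_add, hr, hr,
    AddCircle.coe_sub, add_sub_cancel]

theorem velocity_reparam (hδ' : SmoothCurve δ') (hg : ContDiff ℝ ∞ g)
    (hr : ∀ t : ℝ, r (t : Circ) = (g t : Circ)) {t : ℝ}
    (h : ∀ᶠ φ in 𝓝 (t : Circ), δ' (r φ) = δ φ) :
    velocity δ (t : Circ) = deriv g t • velocity δ' (r (t : Circ)) := by
  rw [velocity_eq, velocity_eq, h.self_of_nhds]
  exact velocityIn_reparam hδ' hg hr (chart_mem_atlas _ _) h (mem_chart_source _ _)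

/-- The velocities differ by the positive factor `deriv g t`, so a defining function for one strand
is one for the other, with the same right hand side. -/
theorem sheet_reparam (hδ : IsImmersedLoop δ) (hδ' : IsImmersedLoop δ') (hS : IsOrientedAtlas S)
    (hg : ContDiff ℝ ∞ g) (hpos : ∀ t, 0 < deriv g t) (hr : ∀ t : ℝ, r (t : Circ) = (g t : Circ))
    {θ : Circ} (h : ∀ᶠ φ in 𝓝 θ, δ' (r φ) = δ φ) :
    ∀ᶠ y in 𝓝 (δ θ), sheet δ θ y = sheet δ' (r θ) y := by
  obtain ⟨t, rfl⟩ := QuotientAddGroup.mk_surjective θ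
  obtain ⟨s, hs⟩ := hδ.exists_isSide (t : Circ)
  have h0 : δ' (r (t : Circ)) = δ (t : Circ) := h.self_of_nhds
  have hs' : IsSide (chartAt Plane (δ (t : Circ))) δ' (r (t : Circ)) s := by
    refine ⟨hs.mem_atlas, ?_, ?_, ?_, ?_⟩
    · rw [h0]
      exact hs.mem_source
    · rw [h0]
      exact hs.contDiffAt
    · rw [← r.map_nhds_eq, eventually_map]
      filter_upwards [h, hs.eq_zero] with φ h1 h2
      rw [h1, h2]
    · obtain ⟨c, hc, hw⟩ := hs.fderiv_eq
      refine ⟨c * deriv g t, mul_pos hc (hpos t), fun w => ?_⟩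
      rw [h0, hw]
      have := velocityIn_reparam hδ'.smooth hg hr hs.mem_atlas h hs.mem_source
      change c * det₂ w (velocityIn _ δ (t : Circ)) = _
      rw [this]
      simp [det₂]
      ring
  have e1 := hs'.sheet_eq hS hδ'
  rw [h0] at e1
  filter_upwards [hs.sheet_eq hS hδ, e1] with y h1 h2
  rw [h1]
  exact h2.symm

variable [T2Space S]

theorem sheetSum_reparam (hδ : IsImmersedLoop δ) (hδ' : IsImmersedLoop δ') (hS : IsOrientedAtlas S)
    (hg : ContDiff ℝ ∞ g) (hpos : ∀ t, 0 < deriv g t) (hr : ∀ t : ℝ, r (t : Circ) = (g t : Circ))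
    {q : S} {A A' : Set Circ} (h1 : ∀ θ, δ θ = q → ∀ᶠ φ in 𝓝 θ, δ' (r φ) = δ φ)
    (h2 : ∀ θ, δ' (r θ) = q → δ θ = q) (h3 : ∀ θ, δ θ = q → (r θ ∈ A' ↔ θ ∈ A)) :
    ∀ᶠ y in 𝓝 q, sheetSum δ A q y = sheetSum δ' A' q y := by
  have hfin := hδ.finite_fiber q
  have e := (eventually_all_finite hfin).2 fun θ (hθ : δ θ = q) => by
    have := sheet_reparam hδ hδ' hS hg hpos hr (h1 θ hθ)
    rwa [hθ] at this
  filter_upwards [e] with y hy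
  rw [sheetSum, sheetSum]
  refine finsum_mem_eq_of_bijOn r ⟨?_, r.injective.injOn, ?_⟩ fun θ hθ => hy θ hθ.2
  · rintro θ ⟨hA, hθ⟩
    exact ⟨(h3 θ hθ).2 hA, by rw [(h1 θ hθ).self_of_nhds, hθ]⟩
  · rintro θ' ⟨hA, hθ⟩
    obtain ⟨θ, rfl⟩ := r.surjective θ'
    exact ⟨θ, ⟨(h3 θ (h2 θ hθ)).1 hA, h2 θ hθ⟩, rfl⟩

theorem cornerSum_reparam (hδ : IsImmersedLoop δ) (hδ' : IsImmersedLoop δ') (hS : IsOrientedAtlas S)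
    (hg : ContDiff ℝ ∞ g) (hpos : ∀ t, 0 < deriv g t) (hr : ∀ t : ℝ, r (t : Circ) = (g t : Circ))
    {q : S} {A A' : Set Circ} {u o : Circ} (huo : δ u = δ o) (hu' : δ' (r u) = δ u)
    (h1 : ∀ θ, δ θ = q → ∀ᶠ φ in 𝓝 θ, δ' (r φ) = δ φ)
    (h2 : ∀ θ, δ' (r θ) = q → δ θ = q) (h3 : ∀ θ, δ θ = q → (r θ ∈ A' ↔ θ ∈ A)) :
    ∀ᶠ y in 𝓝 q, cornerSum δ A u o q y = cornerSum δ' A' (r u) (r o) q y := by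
  by_cases hq : q = δ u
  · have e1 := sheet_reparam hδ hδ' hS hg hpos hr (h1 u hq.symm)
    have e2 := sheet_reparam hδ hδ' hS hg hpos hr (h1 o (huo ▸ hq.symm))
    rw [← huo] at e2
    have hdet : 0 < det₂ (velocity δ u) (velocity δ o) ↔
        0 < det₂ (velocity δ' (r u)) (velocity δ' (r o)) := by
      obtain ⟨t, rfl⟩ := QuotientAddGroup.mk_surjective u
      obtain ⟨s, rfl⟩ := QuotientAddGroup.mk_surjective o
      have e3 := velocity_reparam hδ'.smooth hg hr (h1 _ hq.symm)
      have e4 := velocity_reparam hδ'.smooth hg hr (h1 _ (huo ▸ hq.symm))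
      have : det₂ (velocity δ (t : Circ)) (velocity δ (s : Circ)) = (deriv g t * deriv g s) *
          det₂ (velocity δ' (r (t : Circ))) (velocity δ' (r (s : Circ))) := by
        rw [e3, e4]
        simp [det₂]
        ring
      change 0 < det₂ (velocity δ (t : Circ)) (velocity δ (s : Circ)) ↔ _
      rw [this]
      exact mul_pos_iff_of_pos_left (mul_pos (hpos t) (hpos s))
    rw [← hq] at e1 e2
    filter_upwards [e1, e2] with y h4 h5
    simp only [cornerSum, hu', hq, if_true, h4, h5, hdet]
  · rw [cornerSum_of_ne hq, cornerSum_of_ne (hu' ▸ hq)]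
    exact sheetSum_reparam hδ hδ' hS hg hpos hr h1 h2 h3

end Reparam

/-! ### Crossings, colorings and local moves of diagrams -/

namespace KnotDiagram

variable {S : Type*} [TopologicalSpace S] [ChartedSpace Plane S] {D D' : KnotDiagram S}

theorem isImmersedLoop (D : KnotDiagram S) : IsImmersedLoop D.curve := ⟨D.smooth, D.immersed⟩

/-- The two parameters belong to a crossing, in either order. -/
def IsCorner (D : KnotDiagram S) (u o : Circ) : Prop :=
  (u, o) ∈ D.crossings ∨ (o, u) ∈ D.crossings

theorem Crossing.isCorner (c : D.Crossing) : D.IsCorner (Crossing.under c) (Crossing.over c) :=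
  Or.inr c.2

theorem Crossing.isCorner' (c : D.Crossing) : D.IsCorner (Crossing.over c) (Crossing.under c) :=
  Or.inl c.2

namespace IsCorner

variable {u o : Circ}

theorem symm (h : D.IsCorner u o) : D.IsCorner o u := Or.symm h

theorem ne (h : D.IsCorner u o) : u ≠ o :=
  h.elim (D.ne_of_mem _) fun h => (D.ne_of_mem _ h).symm

theorem curve_eq (h : D.IsCorner u o) : D.curve u = D.curve o :=
  h.elim (D.eq_of_mem _) fun h => (D.eq_of_mem _ h).symm

theorem det_ne_zero (h : D.IsCorner u o) : det₂ (velocity D.curve u) (velocity D.curve o) ≠ 0 := by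
  rcases h with h | h
  · exact D.transverse_of_mem _ h
  · rw [det₂_swap]
    exact neg_ne_zero.2 (D.transverse_of_mem _ h)

theorem eq_or_eq (h : D.IsCorner u o) (θ : Circ) (hθ : D.curve θ = D.curve u) : θ = u ∨ θ = o := by
  rcases D.no_triple θ u o hθ h.curve_eq with h' | h' | h'
  · exact Or.inl h'
  · exact absurd h' h.ne
  · exact Or.inr h'

theorem notMem_range (h : D.IsCorner u o) {γ : C(Circ, S)} (hγ : GeneralPosition γ D) :
    D.curve u ∉ range γ := by
  rcases h with h | h
  · exact hγ.avoids ⟨_, h⟩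
  · have := hγ.avoids ⟨_, h⟩
    rwa [Crossing.point, Crossing.over, D.eq_of_mem _ h] at this

variable [IsManifold (𝓡 2) ∞ S] [T2Space S]

theorem coherent {a b : ℝ} (h : D.IsCorner (a : Circ) (b : Circ)) (hS : IsOrientedAtlas S)
    (hab : a < b) (hba : b < a + 1) :
    Coherent (cornerSum D.curve (circArc a b) (a : Circ) (b : Circ)) :=
  coherent_cornerSum D.isImmersedLoop hS (isArc_circArc hab hba) h.curve_eq h.eq_or_eq h.det_ne_zero

end IsCorner

theorem jump_eq_zero {γ : C(Circ, S)} {θ : Circ} (h : D.curve θ ∉ range γ) : jump γ D θ = 0 := by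
  have : {φ | γ φ = D.curve θ} = ∅ := by
    ext φ
    simp only [mem_ofPred_eq, mem_empty_iff_false, iff_false]
    exact fun h' => h ⟨φ, h'⟩
  rw [jump, this, finsum_mem_empty]

/-- Since both end points are off `γ`, the colors there equal their right limits, and the jumps in
between can be summed. -/
theorem IsColoring.sub_eq {γ : C(Circ, S)} {col : Circ → ℤ} (hcol : IsColoring γ D col) {a b : ℝ}
    (hab : a < b) (hba : b < a + 1) (ha : D.curve (a : Circ) ∉ range γ)
    (hb : D.curve (b : Circ) ∉ range γ) :
    col (b : Circ) - col (a : Circ) = ∑ᶠ θ ∈ circArc a b, jump γ D θ := by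
  have hj : HasJumps (fun t : ℝ => col (t : Circ)) fun t => jump γ D (t : Circ) := fun t => by
    obtain ⟨c, hc, -⟩ := hcol (t : Circ)
    exact ⟨c, by simpa using hc⟩
  have hright : ∀ t : ℝ, D.curve (t : Circ) ∉ range γ →
      ∀ᶠ h in 𝓝[>] (0 : ℝ), col ((t + h : ℝ) : Circ) = col (t : Circ) := fun t ht => by
    obtain ⟨c, hc, hc'⟩ := hcol (t : Circ)
    filter_upwards [hc] with h hh
    rw [AddCircle.coe_add, hh.2, jump_eq_zero ht, add_zero, hc' ht]
  rw [hj.sub_eq_finsum hab.le (hright a ha) (hright b hb), finsum_Ioc_coe (jump γ D) hba.le]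
  rfl

namespace LocalMove

variable {k : ℕ} (m : LocalMove D D' k)

theorem exists_strictMono : ∃ g : ℝ → ℝ, ContDiff ℝ ∞ g ∧ (∀ t, 0 < deriv g t) ∧ StrictMono g ∧
    ∀ t : ℝ, m.reparam (t : Circ) = (g t : Circ) := by
  obtain ⟨g, h1, h2, h3⟩ := m.reparam_smooth
  exact ⟨g, h1, h2, strictMono_of_deriv_pos h2, h3⟩

theorem curve_reparam_mem_disk_iff (θ : Circ) :
    D'.curve (m.reparam θ) ∈ m.disk ↔ D.curve θ ∈ m.disk :=
  (m.mem_disk_iff' θ).trans (m.mem_disk_iff θ).symm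

theorem curve_mem_disk_of_mem_arc {i : Fin k} {θ : Circ} (h : θ ∈ m.arc i) : D.curve θ ∈ m.disk :=
  (m.mem_disk_iff θ).2 ⟨i, h⟩

theorem notMem_arc {θ : Circ} (h : D.curve θ ∉ m.disk) (i : Fin k) : θ ∉ m.arc i :=
  fun h' => h (m.curve_mem_disk_of_mem_arc h')

theorem curve_reparam_mem_disk_of_mem_arc {i : Fin k} {θ : Circ} (h : θ ∈ m.arc i) :
    D'.curve (m.reparam θ) ∈ m.disk :=
  (m.mem_disk_iff' θ).2 ⟨i, h⟩

theorem isClosed_disk [T2Space S] : IsClosed m.disk :=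
  ((isCompact_closedBall 0 1).image_of_continuousOn
    (m.chart.continuousOn_symm.mono m.ball_subset)).isClosed

theorem eventually_curve_eq [T2Space S] {θ : Circ} (h : D.curve θ ∉ m.disk) :
    ∀ᶠ φ in 𝓝 θ, D'.curve (m.reparam φ) = D.curve φ := by
  filter_upwards [D.curve.continuous.continuousAt.eventually
    (m.isClosed_disk.isOpen_compl.mem_nhds h)] with φ hφ
  exact m.curve_eq φ hφ

theorem curve_eq_of_reparam {θ : Circ} {q : S} (hq : q ∉ m.disk)
    (h : D'.curve (m.reparam θ) = q) : D.curve θ = q := by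
  rw [← h]
  refine (m.curve_eq θ fun h' => hq ?_).symm
  rw [← h]
  exact (m.curve_reparam_mem_disk_iff θ).2 h'

theorem exists_mem_arc' {θ : Circ} (h : D'.curve θ ∈ m.disk) : ∃ i, θ ∈ m.arc' i := by
  obtain ⟨φ, rfl⟩ := m.reparam.surjective θ
  obtain ⟨i, hi⟩ := (m.mem_disk_iff' φ).1 h
  exact ⟨i, φ, hi, rfl⟩

/-- The part of `D'` between two points of one arc stays in the disk. Its germs vanish off the disk
and can be compared with the potential `0`. -/
theorem circleDegree_eq_zero [T2Space S] {γ : C(Circ, S)} {i : Fin k} {a b : ℝ}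
    (ha : a ∈ Icc (m.left i) (m.right i)) (hb : b ∈ Icc (m.left i) (m.right i)) {g : ℝ → ℝ}
    (hmono : StrictMono g) (hg : Continuous g) (hr : ∀ t : ℝ, m.reparam (t : Circ) = (g t : Circ))
    {v : S → ℝ}
    (hv : IsPotential v (cornerSum D'.curve (circArc (g a) (g b)) (g a : Circ) (g b : Circ))) :
    circleDegree (hv.toCircle.comp γ) = 0 := by
  have h0 : IsPotential (fun _ : S => (0 : ℝ)) fun _ _ => 0 := fun _ => by
    simpa using continuousAt_const
  have := circleDegree_eq_of_eq_off_disk m.chart m.ball_subset hv h0 (fun q hq => by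
    rw [cornerSum_of_ne, sheetSum_eq_zero]
    · exact EqUpToConst.of_eventuallyEq (Eventually.of_forall fun _ => rfl)
    · rintro θ' hθ' rfl
      obtain ⟨θ, rfl⟩ := m.reparam.surjective θ'
      rw [reparam_coe_mem_circArc hmono hg hr] at hθ'
      obtain ⟨t, ht, rfl⟩ := hθ'
      exact hq (m.curve_reparam_mem_disk_of_mem_arc (i := i)
        ⟨t, ⟨ha.1.trans ht.1.le, ht.2.trans hb.2⟩, rfl⟩)
    · rintro rfl
      rw [← hr] at hq
      exact hq (m.curve_reparam_mem_disk_of_mem_arc (i := i) ⟨a, ha, rfl⟩)) γ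
  rw [this]
  have hlift : IsLift (fun _ => 0) (h0.toCircle.comp γ) := ⟨continuous_const, fun t => rfl⟩
  rw [← hlift.sub_eq_circleDegree, sub_zero]

end LocalMove

/-! ### The index as a degree -/

variable [IsManifold (𝓡 2) ∞ S] [T2Space S]

/-- A curve in general position avoids the corner, so along `γ` the corner germs are plain sums of
sheets and the degree counts the intersections with the part of `D` from `a` to `b`. -/
theorem IsColoring.sub_eq_degree {γ : C(Circ, S)} {col : Circ → ℤ} (hcol : IsColoring γ D col)
    (hγ : GeneralPosition γ D) (hS : IsOrientedAtlas S) {a b : ℝ} (hab : a < b) (hba : b < a + 1)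
    (hc : D.IsCorner (a : Circ) (b : Circ)) {u : S → ℝ}
    (hu : IsPotential u (cornerSum D.curve (circArc a b) (a : Circ) (b : Circ))) :
    ((col (b : Circ) - col (a : Circ) : ℤ) : ℝ) = -circleDegree (hu.toCircle.comp γ) := by
  rw [hcol.sub_eq hab hba (hc.notMem_range hγ) (hc.symm.notMem_range hγ)]
  rw [← finsum_strandJump_eq_degree (A := circArc a b) D.isImmersedLoop hS hγ.smooth hγ.transverse
    hu, ← finsum_mem_jump_eq D.isImmersedLoop hS hγ.smooth hγ.transverse]
  · rfl
  · intro φ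
    exact cornerSum_of_ne fun h => hc.notMem_range hγ ⟨φ, h⟩

/-- The potential depends only on `D` and the chosen lifts, and the degree only on the homotopy
class of `γ`. This is why the choices in the definition of the index do not matter. -/
theorem IsIndexOf.eq_degree {γ : C(Circ, S)} {f : D.Crossing → ℤ} (hf : IsIndexOf γ D f)
    (hS : IsOrientedAtlas S) {c : D.Crossing} {a b : ℝ} (hab : a < b) (hba : b < a + 1)
    (ha : (a : Circ) = Crossing.under c) (hb : (b : Circ) = Crossing.over c) {u : S → ℝ}
    (hu : IsPotential u (cornerSum D.curve (circArc a b) (a : Circ) (b : Circ))) :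
    (f c : ℝ) = -circleDegree (hu.toCircle.comp γ) := by
  obtain ⟨γ₁, hγ, hgp, col, hcol, hf⟩ := hf
  rw [hf, ← ha, ← hb, hcol.sub_eq_degree hgp hS hab hba (by rw [ha, hb]; exact c.isCorner) hu,
    circleDegree_comp_eq hu hγ]

/-- The variant with the complementary loop, from the over- to the under-parameter. It is needed in
a first move in which the over-parameter comes first along the arc. -/
theorem IsIndexOf.eq_degree' {γ : C(Circ, S)} {f : D.Crossing → ℤ} (hf : IsIndexOf γ D f)
    (hS : IsOrientedAtlas S) {c : D.Crossing} {a b : ℝ} (hab : a < b) (hba : b < a + 1)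
    (ha : (a : Circ) = Crossing.over c) (hb : (b : Circ) = Crossing.under c) {u : S → ℝ}
    (hu : IsPotential u (cornerSum D.curve (circArc a b) (a : Circ) (b : Circ))) :
    (f c : ℝ) = circleDegree (hu.toCircle.comp γ) := by
  obtain ⟨γ₁, hγ, hgp, col, hcol, hf⟩ := hf
  have := hcol.sub_eq_degree hgp hS hab hba (by rw [ha, hb]; exact c.isCorner') hu
  rw [circleDegree_comp_eq hu hγ] at this
  rw [hf, ← ha, ← hb]
  push_cast at this ⊢
  linarith

theorem HasIntersectionNumber.eq_degree {γ : C(Circ, S)} {n : ℤ}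
    (h : HasIntersectionNumber γ D n) (hS : IsOrientedAtlas S) {u : S → ℝ}
    (hu : IsPotential u (sheetSum D.curve univ)) :
    (n : ℝ) = -circleDegree (hu.toCircle.comp γ) := by
  obtain ⟨γ₁, hγ, hgp, rfl⟩ := h
  rw [← circleDegree_comp_eq hu hγ, ← finsum_strandJump_univ D.isImmersedLoop hS hgp.smooth
    hgp.transverse]
  exact finsum_strandJump_eq_degree D.isImmersedLoop hS hgp.smooth hgp.transverse hu fun _ => rfl

/-- The obstruction to closing up a coloring after one turn is the total jump, which is the
intersection number. -/
theorem HasIntersectionNumber.exists_isIndexOf {γ : C(Circ, S)}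
    (h : HasIntersectionNumber γ D 0) (hS : IsOrientedAtlas S) : ∃ f, IsIndexOf γ D f := by
  obtain ⟨γ₁, hγ, hgp, h0⟩ := h
  have hfin : (Function.support (jump γ₁ D)).Finite := by
    refine ((finite_intersections D.isImmersedLoop hS hgp.smooth hgp.transverse).image
      Prod.snd).subset fun θ hθ => ?_
    have : D.curve θ ∈ range γ₁ := by
      by_contra h
      exact hθ (jump_eq_zero h)
    obtain ⟨φ, hφ⟩ := this
    exact ⟨(φ, θ), hφ, rfl⟩
  have hsum : ∑ᶠ θ, jump γ₁ D θ = 0 := by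
    rw [← h0, ← finsum_strandJump_univ D.isImmersedLoop hS hgp.smooth hgp.transverse,
      ← finsum_mem_jump_eq D.isImmersedLoop hS hgp.smooth hgp.transverse, finsum_mem_univ]
    rfl
  obtain ⟨col, hcol⟩ := exists_jump_primitive _ hfin hsum
  refine ⟨_, γ₁, hγ, hgp, col, fun θ => ?_, fun _ => rfl⟩
  obtain ⟨a, h1, h2⟩ := hcol θ
  exact ⟨a, h1, fun h => h2 (jump_eq_zero h)⟩

theorem IsIndexOf.unique [CompactSpace S] {γ : C(Circ, S)} {f f' : D.Crossing → ℤ}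
    (hf : IsIndexOf γ D f) (hf' : IsIndexOf γ D f') (hS : IsOrientedAtlas S) : f = f' := by
  ext c
  obtain ⟨a, b, ha, hb, hab, hba⟩ := exists_lifts_of_ne c.isCorner.ne
  have hc : D.IsCorner (a : Circ) (b : Circ) := by rw [ha, hb]; exact c.isCorner
  obtain ⟨u, hu⟩ := (hc.coherent hS hab hba).exists_isPotential
  have := (hf.eq_degree hS hab hba ha hb hu).trans (hf'.eq_degree hS hab hba ha hb hu).symm
  exact_mod_cast this

/-! ### Behavior of the index under local moves -/

namespace LocalMove

variable {k : ℕ} (m : LocalMove D D' k)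

/-- The parts of `D` and `D'` over corresponding parameters have the same germs off the disk. -/
theorem sheetSum_eq (hS : IsOrientedAtlas S) {q : S} (hq : q ∉ m.disk) {A A' : Set Circ}
    (hA : ∀ θ, D.curve θ ∉ m.disk → (m.reparam θ ∈ A' ↔ θ ∈ A)) :
    EqUpToConst q (sheetSum D.curve A q) (sheetSum D'.curve A' q) := by
  obtain ⟨g, hg, hpos, -, hr⟩ := m.exists_strictMono
  exact EqUpToConst.of_eventuallyEq (sheetSum_reparam D.isImmersedLoop D'.isImmersedLoop hS hg hpos
    hr (fun θ hθ => m.eventually_curve_eq (hθ ▸ hq)) (fun θ hθ => m.curve_eq_of_reparam hq hθ)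
    fun θ hθ => hA θ (hθ ▸ hq))

theorem cornerSum_eq (hS : IsOrientedAtlas S) {q : S} (hq : q ∉ m.disk) {A A' : Set Circ}
    {u o : Circ} (hc : D.IsCorner u o) (hu : D.curve u ∉ m.disk)
    (hA : ∀ θ, D.curve θ ∉ m.disk → (m.reparam θ ∈ A' ↔ θ ∈ A)) :
    EqUpToConst q (cornerSum D.curve A u o q)
      (cornerSum D'.curve A' (m.reparam u) (m.reparam o) q) := by
  obtain ⟨g, hg, hpos, -, hr⟩ := m.exists_strictMono
  exact EqUpToConst.of_eventuallyEq (cornerSum_reparam D.isImmersedLoop D'.isImmersedLoop hS hg hpos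
    hr hc.curve_eq (m.curve_eq u hu) (fun θ hθ => m.eventually_curve_eq (hθ ▸ hq))
    (fun θ hθ => m.curve_eq_of_reparam hq hθ) fun θ hθ => hA θ (hθ ▸ hq))

variable {γ : C(Circ, S)}

variable [CompactSpace S]

theorem intersectionNumber_eq (m : LocalMove D D' k) (hS : IsOrientedAtlas S) {n n' : ℤ}
    (h : HasIntersectionNumber γ D n) (h' : HasIntersectionNumber γ D' n') : n' = n := by
  obtain ⟨u, hu⟩ := (coherent_sheetSum_univ D.isImmersedLoop hS).exists_isPotential
  obtain ⟨u', hu'⟩ := (coherent_sheetSum_univ D'.isImmersedLoop hS).exists_isPotential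
  have := circleDegree_eq_of_eq_off_disk m.chart m.ball_subset hu hu'
    (fun q hq => m.sheetSum_eq hS hq fun θ _ => by simp) γ
  have e := h.eq_degree hS hu
  rw [this, ← h'.eq_degree hS hu'] at e
  exact_mod_cast e.symm

/-- The corner lies off the disk, so the sector germs at the corner have to agree as well as the
sheets elsewhere. The reparametrization provides both. -/
theorem index_eq_of_notMem_disk (hS : IsOrientedAtlas S) {f : D.Crossing → ℤ}
    {f' : D'.Crossing → ℤ} (hf : IsIndexOf γ D f) (hf' : IsIndexOf γ D' f') {c : D.Crossing}
    {c' : D'.Crossing} (hc : Crossing.point c ∉ m.disk)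
    (ho : Crossing.over c' = m.reparam (Crossing.over c))
    (hu : Crossing.under c' = m.reparam (Crossing.under c)) : f' c' = f c := by
  obtain ⟨g, hg, hpos, hmono, hr⟩ := m.exists_strictMono
  obtain ⟨a, b, ha, hb, hab, hba⟩ := exists_lifts_of_ne c.isCorner.ne
  have ha' : (g a : Circ) = Crossing.under c' := by rw [hu, ← ha, hr]
  have hb' : (g b : Circ) = Crossing.over c' := by rw [ho, ← hb, hr]
  have hcor : D.IsCorner (a : Circ) (b : Circ) := by rw [ha, hb]; exact c.isCorner
  have hcor' : D'.IsCorner (g a : Circ) (g b : Circ) := by rw [ha', hb']; exact c'.isCorner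
  have hba' := reparam_lt_add_one hg.continuous hr hab hba
  obtain ⟨v, hv⟩ := (hcor.coherent hS hab hba).exists_isPotential
  obtain ⟨v', hv'⟩ := (hcor'.coherent hS (hmono hab) hba').exists_isPotential
  have hpt : D.curve (a : Circ) ∉ m.disk := by
    rw [hcor.curve_eq, hb]
    exact hc
  have := circleDegree_eq_of_eq_off_disk m.chart m.ball_subset hv hv' (fun q hq => by
    rw [← hr, ← hr]
    exact m.cornerSum_eq hS hq hcor hpt
      fun θ _ => reparam_coe_mem_circArc hmono hg.continuous hr θ) γ
  have e := hf.eq_degree hS hab hba ha hb hv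
  rw [this, ← hf'.eq_degree hS (hmono hab) hba' ha' hb' hv'] at e
  exact_mod_cast e.symm

/-- Both corners lie in the disk. With the lifts from `exists_lifts_of_disjoint_arcs`, the two loops
run through corresponding parameters off the disk. -/
theorem index_eq_of_mem_arc (hS : IsOrientedAtlas S) {f : D.Crossing → ℤ}
    {f' : D'.Crossing → ℤ} (hf : IsIndexOf γ D f) (hf' : IsIndexOf γ D' f') {c : D.Crossing}
    {c' : D'.Crossing} {i j : Fin k} (hij : i ≠ j)
    (ho : Crossing.over c ∈ m.arc i) (hu : Crossing.under c ∈ m.arc j)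
    (ho' : Crossing.over c' ∈ m.arc' i) (hu' : Crossing.under c' ∈ m.arc' j) : f' c' = f c := by
  obtain ⟨g, hg, hpos, hmono, hr⟩ := m.exists_strictMono
  obtain ⟨θo, hθo, hro⟩ := ho'
  obtain ⟨θu, hθu, hru⟩ := hu'
  obtain ⟨a, b, a', b', ha, hb, ha', hb', hab, hba, hab', hba', hA⟩ :=
    exists_lifts_of_disjoint_arcs (m.disjoint_arcs j i hij.symm) hu ho hθu hθo
  have hga : (g a' : Circ) = Crossing.under c' := by rw [← hru, ← ha', hr]
  have hgb : (g b' : Circ) = Crossing.over c' := by rw [← hro, ← hb', hr]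
  have hcor : D.IsCorner (a : Circ) (b : Circ) := by rw [ha, hb]; exact c.isCorner
  have hcor' : D'.IsCorner (g a' : Circ) (g b' : Circ) := by rw [hga, hgb]; exact c'.isCorner
  have hgba := reparam_lt_add_one hg.continuous hr hab' hba'
  obtain ⟨v, hv⟩ := (hcor.coherent hS hab hba).exists_isPotential
  obtain ⟨v', hv'⟩ := (hcor'.coherent hS (hmono hab') hgba).exists_isPotential
  have := circleDegree_eq_of_eq_off_disk m.chart m.ball_subset hv hv' (fun q hq => by
    rw [cornerSum_of_ne, cornerSum_of_ne]
    · refine m.sheetSum_eq hS hq fun θ hθ => ?_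
      rw [reparam_coe_mem_circArc hmono hg.continuous hr,
        hA θ (m.notMem_arc hθ j) (m.notMem_arc hθ i)]
    · rintro rfl
      rw [hga, ← hru] at hq
      exact hq (m.curve_reparam_mem_disk_of_mem_arc hθu)
    · rintro rfl
      rw [ha] at hq
      exact hq (m.curve_mem_disk_of_mem_arc hu)) γ
  have e := hf.eq_degree hS hab hba ha hb hv
  rw [this, ← hf'.eq_degree hS (hmono hab') hgba hga hgb hv'] at e
  exact_mod_cast e.symm

/-- The same comparison for two crossings of one diagram: their loops differ only by pieces of the
two arcs inside the disk. -/
theorem index_eq_of_mem_arc' (hS : IsOrientedAtlas S) {f' : D'.Crossing → ℤ}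
    (hf' : IsIndexOf γ D' f') {c₁ c₂ : D'.Crossing} {i j : Fin k} (hij : i ≠ j)
    (ho₁ : Crossing.over c₁ ∈ m.arc' i) (hu₁ : Crossing.under c₁ ∈ m.arc' j)
    (ho₂ : Crossing.over c₂ ∈ m.arc' i) (hu₂ : Crossing.under c₂ ∈ m.arc' j) : f' c₁ = f' c₂ := by
  obtain ⟨g, hg, hpos, hmono, hr⟩ := m.exists_strictMono
  obtain ⟨θo, hθo, hro⟩ := ho₁
  obtain ⟨θu, hθu, hru⟩ := hu₁
  obtain ⟨φo, hφo, hso⟩ := ho₂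
  obtain ⟨φu, hφu, hsu⟩ := hu₂
  obtain ⟨a, b, a', b', ha, hb, ha', hb', hab, hba, hab', hba', hA⟩ :=
    exists_lifts_of_disjoint_arcs (m.disjoint_arcs j i hij.symm) hθu hθo hφu hφo
  have hga : (g a : Circ) = Crossing.under c₁ := by rw [← hru, ← ha, hr]
  have hgb : (g b : Circ) = Crossing.over c₁ := by rw [← hro, ← hb, hr]
  have hga' : (g a' : Circ) = Crossing.under c₂ := by rw [← hsu, ← ha', hr]
  have hgb' : (g b' : Circ) = Crossing.over c₂ := by rw [← hso, ← hb', hr]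
  have hcor : D'.IsCorner (g a : Circ) (g b : Circ) := by rw [hga, hgb]; exact c₁.isCorner
  have hcor' : D'.IsCorner (g a' : Circ) (g b' : Circ) := by rw [hga', hgb']; exact c₂.isCorner
  have hgba := reparam_lt_add_one hg.continuous hr hab hba
  have hgba' := reparam_lt_add_one hg.continuous hr hab' hba'
  obtain ⟨v, hv⟩ := (hcor.coherent hS (hmono hab) hgba).exists_isPotential
  obtain ⟨v', hv'⟩ := (hcor'.coherent hS (hmono hab') hgba').exists_isPotential
  have := circleDegree_eq_of_eq_off_disk m.chart m.ball_subset hv hv' (fun q hq => by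
    rw [cornerSum_of_ne, cornerSum_of_ne]
    · refine EqUpToConst.of_eventuallyEq (Eventually.of_forall fun y => ?_)
      refine finsum_mem_congr ?_ fun _ _ => rfl
      ext θ'
      obtain ⟨θ, rfl⟩ := m.reparam.surjective θ'
      refine and_congr_left fun hθ => ?_
      have hθ' : D.curve θ ∉ m.disk := by
        rw [← m.curve_reparam_mem_disk_iff, hθ]
        exact hq
      rw [reparam_coe_mem_circArc hmono hg.continuous hr,
        reparam_coe_mem_circArc hmono hg.continuous hr,
        hA θ (m.notMem_arc hθ' j) (m.notMem_arc hθ' i)]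
    · rintro rfl
      rw [hga', ← hsu] at hq
      exact hq (m.curve_reparam_mem_disk_of_mem_arc hφu)
    · rintro rfl
      rw [hga, ← hru] at hq
      exact hq (m.curve_reparam_mem_disk_of_mem_arc hθu)) γ
  have e := hf'.eq_degree hS (hmono hab) hgba hga hgb hv
  rw [this, ← hf'.eq_degree hS (hmono hab') hgba' hga' hgb' hv'] at e
  exact_mod_cast e

theorem index_eq_zero (hS : IsOrientedAtlas S) {f' : D'.Crossing → ℤ}
    (hf' : IsIndexOf γ D' f') {c : D'.Crossing} {i : Fin k}
    (ho : Crossing.over c ∈ m.arc' i) (hu : Crossing.under c ∈ m.arc' i) : f' c = 0 := by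
  obtain ⟨g, hg, hpos, hmono, hr⟩ := m.exists_strictMono
  obtain ⟨_, ⟨b, hb, rfl⟩, hro⟩ := ho
  obtain ⟨_, ⟨a, ha, rfl⟩, hru⟩ := hu
  have hga : (g a : Circ) = Crossing.under c := by rw [← hru, ← hr]
  have hgb : (g b : Circ) = Crossing.over c := by rw [← hro, ← hr]
  have hlt := m.right_lt i
  -- The loop staying inside the arc starts at whichever of the two parameters comes first.
  rcases lt_trichotomy a b with hab | rfl | hab
  · have hcor : D'.IsCorner (g a : Circ) (g b : Circ) := by rw [hga, hgb]; exact c.isCorner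
    have hgba := reparam_lt_add_one hg.continuous hr hab (by linarith [hb.2, ha.1])
    obtain ⟨v, hv⟩ := (hcor.coherent hS (hmono hab) hgba).exists_isPotential
    have e := hf'.eq_degree hS (hmono hab) hgba hga hgb hv
    rw [m.circleDegree_eq_zero ha hb hmono hg.continuous hr hv, neg_zero] at e
    exact_mod_cast e
  · exact absurd (hga.symm.trans hgb) c.isCorner.ne
  · have hcor : D'.IsCorner (g b : Circ) (g a : Circ) := by rw [hga, hgb]; exact c.isCorner'
    have hgba := reparam_lt_add_one hg.continuous hr hab (by linarith [hb.1, ha.2])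
    obtain ⟨v, hv⟩ := (hcor.coherent hS (hmono hab) hgba).exists_isPotential
    have e := hf'.eq_degree' hS (hmono hab) hgba hgb hga hv
    rw [m.circleDegree_eq_zero hb ha hmono hg.continuous hr hv] at e
    exact_mod_cast e

end LocalMove

theorem isChordIndex [CompactSpace S] (hS : IsOrientedAtlas S) {γ : C(Circ, S)}
    {f : (D : KnotDiagram S) → D.Crossing → ℤ}
    (hf : ∀ D : KnotDiagram S, HasIntersectionNumber γ D 0 → IsIndexOf γ D (f D)) :
    IsChordIndex {D | HasIntersectionNumber γ D 0} f where
  axiom₁ D _ D' hD' m _ c hc := by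
    obtain ⟨i, hi⟩ := m.exists_mem_arc' hc
    obtain ⟨j, hj⟩ := m.exists_mem_arc' (θ := Crossing.under c) (by
      rw [c.isCorner.curve_eq]
      exact hc)
    -- A first move has a single arc, so both branches of the crossing belong to it.
    rw [Subsingleton.elim j i] at hj
    exact m.index_eq_zero hS (hf D' hD') hi hj
  axiom₂ D _ D' hD' m hm c₁ c₂ h₁ h₂ :=
    m.index_eq_of_mem_arc' hS (hf D' hD') zero_ne_one (hm.2.2 c₁ h₁).1 (hm.2.2 c₁ h₁).2
      (hm.2.2 c₂ h₂).1 (hm.2.2 c₂ h₂).2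
  axiom₃ D hD D' hD' m hm i j c c' ho hu ho' hu' := by
    refine m.index_eq_of_mem_arc hS (hf D hD) (hf D' hD') ?_ ho hu ho' hu'
    -- In a third move no arc crosses itself, so the two labels differ.
    rintro rfl
    exact hm.2.1 i i (lt_irrefl i) ⟨c, ho, hu⟩
  axiom₄ D hD D' hD' k m _ c c' hc ho hu :=
    m.index_eq_of_notMem_disk hS (hf D hD) (hf D' hD') hc ho hu

end KnotDiagram

end

theorem lemma2p2 {S : Type*} [TopologicalSpace S] [T2Space S] [CompactSpace S]
    [ChartedSpace Plane S] [IsManifold (𝓡 2) ∞ S] (hS : IsOrientedAtlas S)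
    (γ : C(Circ, S)) :
    (∀ D : KnotDiagram S, KnotDiagram.HasIntersectionNumber γ D 0 →
      ∃! f : D.Crossing → ℤ, KnotDiagram.IsIndexOf γ D f) ∧
    (∀ (D D' : KnotDiagram S) (k : ℕ) (m : KnotDiagram.LocalMove D D' k),
      KnotDiagram.IsReidemeister m → ∀ n n' : ℤ,
      KnotDiagram.HasIntersectionNumber γ D n → KnotDiagram.HasIntersectionNumber γ D' n' →
      n' = n) ∧
    (∀ f : (D : KnotDiagram S) → D.Crossing → ℤ,
      (∀ D : KnotDiagram S, KnotDiagram.HasIntersectionNumber γ D 0 →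
        KnotDiagram.IsIndexOf γ D (f D)) →
      KnotDiagram.IsChordIndex {D | KnotDiagram.HasIntersectionNumber γ D 0} f) :=
  ⟨fun D hD => by
    obtain ⟨f, hf⟩ := hD.exists_isIndexOf hS
    exact ⟨f, hf, fun f' hf' => hf'.unique hf hS⟩,
  fun D D' k m _ n n' h h' => m.intersectionNumber_eq hS h h',
  fun f hf => KnotDiagram.isChordIndex hS hf⟩
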